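/- A permutation $\tau\in S_n$ is \emph{$321$-avoiding} if there are no indices $i_1<i_2<i_3$ with $\tau(i_1)>\tau(i_2)>\tau(i_3)$; let $\mathrm{Av}_n(321)$ be the set of such permutations. A \emph{rooted ordered tree} is a set $\mathbf t$ of finite words over $\{1,2,\dots\}$ that contains the empty word, is closed under prefixes, and is such that $ui\in\mathbf t$ and $1\le j\le i$ imply $uj\in\mathbf t$; it is \emph{locally finite} if $d_{\mathbf t}(u)=\max(0,\sup\{i: ui\in\mathbf t\})<\infty$ for every $u\in\mathbf t$. Put $d_{\mathbf t}(u)=-1$ for $u\notin\mathbf t$. The set $\mathfrak T$ of locally finite rooted ordered trees carries the topology in which $\mathbf t_n\to\mathbf t$ iff $d_{\mathbf t_n}(u)\to d_{\mathbf t}(u)$ for every word $u$, and its Borel $\sigma$-algebra. Let $\#\mathbf t$ be the number of vertices of $\mathbf t$. With $\xi(n)=2^{-n-1}$, $n\ge 0$, a \emph{Geometric$(1/2)$-Galton--Watson tree} is a $\mathfrak T$-valued random variable $T$ with $\mathbb P(T=\mathbf t)=\prod_{u\in\mathbf t}\xi(d_{\mathbf t}(u))$ for all $\mathbf t\in\mathfrak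 T$; such a tree is almost surely finite. \textbf{Theorem.} Let $\mathcal T_1,\mathcal T_2,\dots$ be an i.i.d. sequence of Geometric$(1/2)$-Galton--Watson trees, and let $(\tilde X,N)$ be a pair of $\{1,2,\dots\}$-valued random variables, independent of $(\mathcal T_j)_{j\ge1}$, such that $\mathbb P(\tilde X=k)=k\,2^{-k-1}$ for $k\ge 1$ and, conditionally given $\tilde X=k$, $N$ is uniformly distributed on $\{1,\dots,k\}$. If, for each $n$, $\tau_n$ is a uniformly random element of $\mathrm{Av}_n(321)$, then, as $n\to\infty$, \[ \left( \sum_{i=1}^{\lfloor n/2\rfloor} \delta_i \mathbf 1_{\{\tau_n(i)=i\}},\ \sum_{i=\lfloor n/2\rfloor+1}^{n} \delta_{n+1-i} \mathbf 1_{\{\tau_n(i)=i\}} \right) \overset{d}{\longrightarrow} \left( \sum_{i=1}^{N-1} \delta_{\sum_{j=1}^{i} \#\mathcal T_j} \mathbf 1_{\{\#\mathcal T_i=1\}},\ \sum_{i=N+1}^{\tilde X} \delta_{\sum_{j=i}^{\tilde X} \#\mathcal T_j} \mathbf 1_{\{\#\mathcal T_i=1\}} \right), \] the convergence being convergence in distribution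 on $\mathcal M_F(\{1,2,3,\dots\})^2$, where $\mathcal M_F(\{1,2,3,\dots\})$ is the set of finite measures on $\{1,2,3,\dots\}$ with the topology of weak convergence. -/

import Mathlib

open MeasureTheory ProbabilityTheory Filter
open scoped ENNReal

noncomputable section

/-! ### Pattern-avoiding permutations -/

/-- `τ ∈ S_n` contains an instance of the pattern `σ ∈ S_k`: there are indices
`i₁ < ⋯ < i_k` with `τ (i_s) < τ (i_t) ↔ σ s < σ t` for all `s < t`. -/
def ContainsPattern {n k : ℕ} (τ : Equiv.Perm (Fin n)) (σ : Equiv.Perm (Fin k)) : Prop :=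
  ∃ i : Fin k → Fin n, StrictMono i ∧ ∀ s t : Fin k, s < t → (τ (i s) < τ (i t) ↔ σ s < σ t)

/-- The pattern `321`, i.e. the order-reversing permutation of three letters. -/
def pattern321 : Equiv.Perm (Fin 3) := Fin.revPerm

/-- The set of `321`-avoiding permutations in `S_n`. -/
def Av321 (n : ℕ) : Set (Equiv.Perm (Fin n)) := {τ | ¬ ContainsPattern τ pattern321}

instance instMeasurableSpacePermFin (n : ℕ) : MeasurableSpace (Equiv.Perm (Fin n)) := ⊤

/-! ### Rooted ordered trees as subtrees of the Ulam–Harris tree -/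

/-- A locally finite rooted ordered tree: a set of finite words over `{1, 2, …}` containing the
empty word, closed under prefixes (ancestors) and under elder siblings, in which every vertex has
finitely many children. -/
@[ext]
structure OrderedTree where
  verts : Set (List ℕ+)
  root_mem : [] ∈ verts
  ancestor_mem : ∀ v w : List ℕ+, v ++ w ∈ verts → v ∈ verts
  sibling_mem : ∀ (u : List ℕ+) (i j : ℕ+), u ++ [i] ∈ verts → j ≤ i → u ++ [j] ∈ verts
  locallyFinite : ∀ u : List ℕ+, {i : ℕ+ | u ++ [i] ∈ verts}.Finite

namespace OrderedTree

/-- `0 ∨ sup {i : ui ∈ t}`, the number of children of `u` in `t`. -/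
def numChildren (t : OrderedTree) (u : List ℕ+) : ℕ :=
  sSup ((fun i : ℕ+ => (i : ℕ)) '' {i : ℕ+ | u ++ [i] ∈ t.verts})

open Classical in
/-- `d_t(u)`: the number of children of `u` if `u ∈ t`, and `-1` otherwise. -/
def deg (t : OrderedTree) (u : List ℕ+) : ℤ :=
  if u ∈ t.verts then (t.numChildren u : ℤ) else -1

/-- The number of vertices `#t`. -/
def size (t : OrderedTree) : ℕ∞ := t.verts.encard

/-- The local topology: `t_n → t` iff `d_{t_n}(u) → d_t(u)` for every word `u`. -/
instance : TopologicalSpace OrderedTree :=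
  TopologicalSpace.induced (fun t u => t.deg u) inferInstance

instance : MeasurableSpace OrderedTree := borel OrderedTree

instance : BorelSpace OrderedTree := ⟨rfl⟩

end OrderedTree

/-! ### Galton–Watson trees -/

/-- `T` is a Galton–Watson tree with offspring distribution `ξ` (a law of mean `1`):
`P(T = t) = ∏_{u ∈ t} ξ(d_t(u))` for every locally finite tree `t`. -/
def IsGaltonWatsonTree {Ω : Type*} [MeasurableSpace Ω] (ξ : PMF ℕ) (T : Ω → OrderedTree)
    (μ : Measure Ω) : Prop :=
  Measurable T ∧ ∀ t : OrderedTree, μ (T ⁻¹' {t}) = ∏' u : t.verts, ξ (t.numChildren u)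

/-- The Geometric(1/2) distribution `ξ(n) = 2^{-n-1}` on `{0, 1, 2, …}`. -/
def geomHalf : PMF ℕ :=
  ⟨fun n => (2⁻¹ : ℝ≥0∞) ^ (n + 1), by
    have h : ∑' n : ℕ, (2⁻¹ : ℝ≥0∞) ^ (n + 1) = 1 := by
      rw [ENNReal.tsum_geometric_add_one, ENNReal.one_sub_inv_two, inv_inv]
      exact ENNReal.inv_mul_cancel two_ne_zero ENNReal.ofNat_ne_top
    exact h ▸ ENNReal.summable.hasSum⟩

/-- The size-biased weights `n ξ(n)`, a probability distribution when `ξ` has mean `1`. -/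
def sizeBiased (ξ : PMF ℕ) (n : ℕ) : ℝ≥0∞ := n * ξ n

/-! ### Finite measures on `{1, 2, 3, …}` -/

instance instMeasurableSpacePNat : MeasurableSpace ℕ+ := ⊤

instance instBorelSpacePNat : BorelSpace ℕ+ :=
  ⟨(borel_eq_top_of_discrete (α := ℕ+)).symm⟩

/-- The Dirac mass at `x`. -/
def diracFM (x : ℕ+) : FiniteMeasure ℕ+ := ⟨Measure.dirac x, inferInstance⟩

/-- `M_F({1, 2, 3, …})²`, with the product of the weak topologies and its Borel `σ`-algebra. -/
def FiniteMeasurePair : Type := FiniteMeasure ℕ+ × FiniteMeasure ℕ+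

instance : TopologicalSpace FiniteMeasurePair :=
  inferInstanceAs (TopologicalSpace (FiniteMeasure ℕ+ × FiniteMeasure ℕ+))

instance : MeasurableSpace FiniteMeasurePair := borel FiniteMeasurePair

instance : BorelSpace FiniteMeasurePair := ⟨rfl⟩

/-- `∑_{i=1}^{⌊n/2⌋} δ_i 1{τ(i) = i}`. The index `a : Fin n` stands for `i = a + 1`. -/
def fixedPointsLeft {n : ℕ} (τ : Equiv.Perm (Fin n)) : FiniteMeasure ℕ+ :=
  ∑ a : Fin n, if (a : ℕ) + 1 ≤ n / 2 ∧ τ a = a then diracFM (Nat.succPNat a) else 0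

/-- `∑_{i=⌊n/2⌋+1}^{n} δ_{n+1-i} 1{τ(i) = i}`. The index `a : Fin n` stands for `i = a + 1`, so
that `n + 1 - i = (n - 1 - a) + 1`, where `n - 1 - a` is `Fin.rev a`. -/
def fixedPointsRight {n : ℕ} (τ : Equiv.Perm (Fin n)) : FiniteMeasure ℕ+ :=
  ∑ a : Fin n, if n / 2 + 1 ≤ (a : ℕ) + 1 ∧ τ a = a then diracFM (Nat.succPNat a.rev) else 0

/-- The pair of fixed-point measures of a permutation. -/
def fixedPointPair {n : ℕ} (τ : Equiv.Perm (Fin n)) : FiniteMeasurePair :=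
  (fixedPointsLeft τ, fixedPointsRight τ)

/-- `∑_{j=a}^{b} #t_j` as an element of `{1, 2, 3, …}`; the value is irrelevant (it is `1`) if some
tree is infinite, an event of probability zero for Galton–Watson trees of mean offspring `1`. -/
def cumulativeSize (t : ℕ+ → OrderedTree) (a b : ℕ+) : ℕ+ :=
  (∑ j ∈ Finset.Icc a b, (t j).size).toNat.toPNat'

open Classical in
/-- `∑_{i=1}^{N-1} δ_{∑_{j=1}^{i} #t_j} 1{#t_i = 1}`. -/
def spineLeft (t : ℕ+ → OrderedTree) (N : ℕ+) : FiniteMeasure ℕ+ :=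
  ∑ i ∈ Finset.Ico 1 N, if (t i).size = 1 then diracFM (cumulativeSize t 1 i) else 0

open Classical in
/-- `∑_{i=N+1}^{X} δ_{∑_{j=i}^{X} #t_j} 1{#t_i = 1}`. -/
def spineRight (t : ℕ+ → OrderedTree) (X N : ℕ+) : FiniteMeasure ℕ+ :=
  ∑ i ∈ Finset.Ioc N X, if (t i).size = 1 then diracFM (cumulativeSize t i X) else 0

/-- The pair of measures to the left and to the right of the spine. -/
def spinePair (t : ℕ+ → OrderedTree) (X N : ℕ+) : FiniteMeasurePair :=
  (spineLeft t N, spineRight t X N)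

end

/-!
Split a `321`-avoiding permutation at its fixed points. Every fixed point `f` splits it into
`321`-avoiding permutations of the values below and above `f`, so the number of `321`-avoiding
permutations with prescribed fixed points near both ends is a product of Fine numbers (the numbers
`F_m` of `321`-avoiding derangements), one for each gap; only the middle gap has size of order `n`.
From the recursion of the Fine numbers and `C_{n+1} = 2 F_{n+1} + F_n` one gets
`F_n / C_{n+k} → (4/9) 4^{-k}`, which gives the limit of every point probability.

On the other side, a Galton–Watson tree has size `s` with probability `2 C_{s-1} 4^{-s}`, and the
powers of `2` cancel against the law of the pair `(X, N)`: the lists of tree sizes on the two sides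
of the spine are independent sequences of parts of weight `C_{s-1} 4^{-s}`. Decomposing such a
sequence at its parts of size one (its hills) produces the Fine numbers again, since `F_m` is the
sum of the products `∏ C_{s-1}` over the sequences of parts `s ≥ 2` with total `m`; hence the two
point probabilities agree. On a countable discrete space, convergence of the point probabilities to
those of a probability measure is convergence in distribution.
-/

/-! ### Counting 321-avoiding permutations -/

section AppendValue

variable {n : ℕ}

theorem mem_Av321_iff {τ : Equiv.Perm (Fin n)} :
    τ ∈ Av321 n ↔ ∀ i j k : Fin n, i < j → j < k → τ j < τ i → ¬ τ k < τ j := by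
  constructor
  · intro h i j k hij hjk hji hkj
    refine h ⟨![i, j, k], by simp [Fin.strictMono_iff_lt_succ, Fin.forall_fin_two, *], ?_⟩
    intro s t hst
    fin_cases s <;> fin_cases t <;>
      simp [pattern321, hji.le, hkj.le, (hkj.trans hji).le] at hst ⊢
  · rintro h ⟨f, hf, hpattern⟩
    have hdesc : ∀ s t : Fin 3, s < t → τ (f t) < τ (f s) := fun s t hst =>
      (not_lt.1 fun hlt =>
          hst.not_gt (by simpa [pattern321] using (hpattern s t hst).1 hlt)).lt_of_ne
        fun heq => (hf hst).ne' (τ.injective heq)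
    exact h _ _ _ (hf (by decide : (0 : Fin 3) < 1)) (hf (by decide : (1 : Fin 3) < 2))
      (hdesc _ _ (by decide)) (hdesc _ _ (by decide))

/-- The smaller value of every inversion of `τ` is less than `v`. A new last value `v` creates a
pattern `321` in a `321`-avoiding permutation exactly when this fails. -/
def InvBelow (τ : Equiv.Perm (Fin n)) (v : ℕ) : Prop :=
  ∀ i j : Fin n, i < j → τ j < τ i → (τ j : ℕ) < v

theorem InvBelow.mono {τ : Equiv.Perm (Fin n)} {v w : ℕ} (h : InvBelow τ v) (hvw : v ≤ w) :
    InvBelow τ w :=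
  fun i j hij hji => (h i j hij hji).trans_le hvw

theorem invBelow_of_le_add_one (τ : Equiv.Perm (Fin n)) {v : ℕ} (hv : n ≤ v + 1) :
    InvBelow τ v := by
  intro i j _ hji
  have := (τ i).isLt
  rw [Fin.lt_def] at hji
  omega

/-- The permutation of `Fin (n + 1)` with last value `u` whose other values are in the relative
order prescribed by `τ`. -/
def appendValue (u : Fin (n + 1)) (τ : Equiv.Perm (Fin n)) : Equiv.Perm (Fin (n + 1)) :=
  (finSuccEquiv' (Fin.last n)).trans (τ.optionCongr.trans (finSuccEquiv' u).symm)

@[simp]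
theorem appendValue_last (u : Fin (n + 1)) (τ : Equiv.Perm (Fin n)) :
    appendValue u τ (Fin.last n) = u := by
  simp [appendValue]

@[simp]
theorem appendValue_castSucc (u : Fin (n + 1)) (τ : Equiv.Perm (Fin n)) (i : Fin n) :
    appendValue u τ i.castSucc = u.succAbove (τ i) := by
  simp [appendValue, finSuccEquiv'_last_apply_castSucc]

theorem appendValue_bijective :
    Function.Bijective
      (fun p : Fin (n + 1) × Equiv.Perm (Fin n) => appendValue p.1 p.2) := by
  refine (Fintype.bijective_iff_injective_and_card _).2
    ⟨?_, by simp [Fintype.card_perm, Nat.factorial_succ]⟩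
  rintro ⟨u, τ⟩ ⟨u', τ'⟩ h
  obtain rfl : u = u' := by simpa using congrArg (fun σ => σ (Fin.last n)) h
  refine Prod.ext rfl (Equiv.ext fun i => ?_)
  simpa using congrArg (fun σ => σ i.castSucc) h

theorem succAbove_le_iff_val_lt {u : Fin (n + 1)} {x : Fin n} :
    u.succAbove x ≤ u ↔ (x : ℕ) < u := by
  rw [(Fin.succAbove_ne u x).le_iff_lt, Fin.succAbove_lt_iff_castSucc_lt, Fin.lt_def,
    Fin.val_castSucc]

theorem appendValue_mem_Av321_iff {u : Fin (n + 1)} {τ : Equiv.Perm (Fin n)} :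
    appendValue u τ ∈ Av321 (n + 1) ↔ τ ∈ Av321 n ∧ InvBelow τ u := by
  simp [mem_Av321_iff, InvBelow, Fin.forall_fin_succ', Fin.castSucc_lt_last,
    (Fin.castSucc_lt_last _).not_gt, forall_and, succAbove_le_iff_val_lt]

theorem val_succAbove_of_lt {u : Fin (n + 1)} {x : Fin n} (h : (x : ℕ) < u) :
    (u.succAbove x : ℕ) = x := by
  rw [Fin.succAbove_of_castSucc_lt _ _ h, Fin.val_castSucc]

theorem invBelow_appendValue_iff {u : Fin (n + 1)} {τ : Equiv.Perm (Fin n)} (h : InvBelow τ u)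
    {v : ℕ} : InvBelow (appendValue u τ) v ↔ InvBelow τ v ∧ ((u : ℕ) < n → (u : ℕ) < v) := by
  have h_cast : (∀ i j : Fin n, i < j → τ j < τ i → (u.succAbove (τ j) : ℕ) < v) ↔ InvBelow τ v :=
    forall₄_congr fun i j hij hji => by rw [val_succAbove_of_lt (h i j hij hji)]
  have h_last : (∀ i, u ≤ (τ i).castSucc → (u : ℕ) < v) ↔ ((u : ℕ) < n → (u : ℕ) < v) := by
    rw [← τ.surjective.forall (p := fun x => u ≤ x.castSucc → (u : ℕ) < v)]
    exact ⟨fun H hu => H ⟨u, hu⟩ le_rfl, fun H x hx => H (lt_of_le_of_lt hx x.isLt)⟩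
  rw [← h_cast, ← h_last]
  simp [InvBelow, Fin.forall_fin_succ', (Fin.castSucc_lt_last _).not_gt,
    Fin.lt_succAbove_iff_le_castSucc, Fin.castSucc_lt_last, forall_and]

/-- The number of `321`-avoiding permutations of `Fin n` in which every inversion has its smaller
value below `v`: for `v ≤ n`, the entries of Catalan's triangle. -/
noncomputable def invBelowCount (n v : ℕ) : ℕ :=
  {τ : Equiv.Perm (Fin n) | τ ∈ Av321 n ∧ InvBelow τ v}.ncard

theorem invBelowCount_of_le_add_one {v : ℕ} (h : n ≤ v + 1) :
    invBelowCount n v = (Av321 n).ncard := by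
  simp [invBelowCount, invBelow_of_le_add_one _ h]

theorem invBelowCount_succ_eq_sum (n v : ℕ) :
    invBelowCount (n + 1) v = ∑ u : Fin (n + 1),
      {τ : Equiv.Perm (Fin n) | (τ ∈ Av321 n ∧ InvBelow τ u) ∧
        InvBelow τ v ∧ ((u : ℕ) < n → (u : ℕ) < v)}.ncard := by
  classical
  simp only [invBelowCount, Set.ncard_eq_toFinset_card', Set.toFinset_ofPred, Finset.card_filter]
  rw [← (Equiv.ofBijective _ appendValue_bijective).sum_comp, Fintype.sum_prod_type]
  refine Finset.sum_congr rfl fun u _ => Finset.sum_congr rfl fun τ _ => if_congr ?_ rfl rfl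
  rw [Equiv.ofBijective_apply, appendValue_mem_Av321_iff]
  exact and_congr_right fun h => invBelow_appendValue_iff h.2

theorem invBelowCount_succ_left {v : ℕ} (hv : v ≤ n) :
    invBelowCount (n + 1) v = invBelowCount n v + ∑ u ∈ Finset.range v, invBelowCount n u := by
  have hterm (u : Fin n) : {τ : Equiv.Perm (Fin n) | (τ ∈ Av321 n ∧ InvBelow τ u.castSucc) ∧
      InvBelow τ v ∧ ((u.castSucc : ℕ) < n → (u.castSucc : ℕ) < v)}.ncard =
        if (u : ℕ) < v then invBelowCount n u else 0 := by
    split_ifs with huv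
    · refine congrArg Set.ncard (Set.ext fun τ => ?_)
      exact ⟨fun h => h.1, fun h => ⟨h, h.2.mono huv.le, fun _ => huv⟩⟩
    · simp [huv]
  rw [invBelowCount_succ_eq_sum, Fin.sum_univ_castSucc, add_comm]
  congr 1
  · simp [invBelowCount, invBelow_of_le_add_one]
  · simp only [hterm]
    rw [Fin.sum_univ_eq_sum_range (fun u => if u < v then invBelowCount n u else 0),
      ← Finset.sum_filter]
    congr 1
    grind

theorem invBelowCount_succ_succ {v : ℕ} (hv : v + 1 ≤ n) :
    invBelowCount (n + 1) (v + 1) = invBelowCount (n + 1) v + invBelowCount n (v + 1) := by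
  rw [invBelowCount_succ_left hv, invBelowCount_succ_left (by omega), Finset.sum_range_succ]
  ring

theorem add_one_mul_invBelowCount (v d : ℕ) :
    (v + d + 1) * invBelowCount (v + d) v = (d + 1) * (2 * v + d).choose v := by
  induction v generalizing d with
  | zero =>
    have hone : invBelowCount d 0 = 1 := by
      induction d with
      | zero => simp [invBelowCount, mem_Av321_iff, InvBelow]
      | succ d ih => simp [invBelowCount_succ_left, ih]
    simp [hone]
  | succ v ihv =>
    induction d with
    | zero =>
      rw [add_zero, invBelowCount_of_le_add_one (by omega),
        ← invBelowCount_of_le_add_one (v := v) le_rfl]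
      linear_combination ihv 1 + (Nat.choose_succ_succ' (2 * v + 1) v).symm +
        (Nat.choose_symm_half v).symm
    | succ d ihd =>
      have hsplit := invBelowCount_succ_succ (show v + 1 ≤ v + 1 + d by omega)
      have hpascal := Nat.choose_succ_succ' (2 * v + d + 2) v
      have hratio := Nat.choose_succ_right_eq (2 * v + d + 2) v
      have hleft := ihv (d + 2)
      rw [show 2 * v + d + 2 - v = v + d + 2 by omega] at hratio
      rw [show v + (d + 2) = v + 1 + d + 1 by ring, show 2 * v + (d + 2) = 2 * v + d + 2 by ring]
        at hleft
      rw [show 2 * (v + 1) + d = 2 * v + d + 2 by ring] at ihd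
      rw [show v + 1 + (d + 1) = v + 1 + d + 1 by ring, hsplit,
        show 2 * (v + 1) + (d + 1) = 2 * v + d + 2 + 1 by ring, hpascal]
      refine Nat.eq_of_mul_eq_mul_left (show 0 < v + d + 2 by omega) ?_
      linear_combination (v + d + 2) * hleft + (v + d + 3) * ihd + hratio.symm

theorem ncard_Av321 (n : ℕ) : (Av321 n).ncard = catalan n := by
  have h := add_one_mul_invBelowCount n 0
  rw [add_zero, invBelowCount_of_le_add_one n.le_succ, zero_add, one_mul, add_zero,
    ← Nat.centralBinom, ← succ_mul_catalan_eq_centralBinom] at h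
  exact Nat.eq_of_mul_eq_mul_left n.succ_pos h

end AppendValue

/-! ### Fixed points of 321-avoiding permutations -/

section DirectSum

variable {n a b f : ℕ}

/-- The permutation of `Fin (a + b)` that acts as `α` on the first `a` indices and as `β` on the
last `b` indices. -/
def directSum (α : Equiv.Perm (Fin a)) (β : Equiv.Perm (Fin b)) : Equiv.Perm (Fin (a + b)) :=
  finSumFinEquiv.permCongr (Equiv.Perm.sumCongr α β)

@[simp]
theorem directSum_castAdd (α : Equiv.Perm (Fin a)) (β : Equiv.Perm (Fin b)) (i : Fin a) :
    directSum α β (Fin.castAdd b i) = Fin.castAdd b (α i) := by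
  simp [directSum, Equiv.permCongr_apply]

@[simp]
theorem directSum_natAdd (α : Equiv.Perm (Fin a)) (β : Equiv.Perm (Fin b)) (i : Fin b) :
    directSum α β (Fin.natAdd a i) = Fin.natAdd a (β i) := by
  simp [directSum, Equiv.permCongr_apply]

theorem directSum_injective : Function.Injective
    (fun p : Equiv.Perm (Fin a) × Equiv.Perm (Fin b) => directSum p.1 p.2) :=
  (finSumFinEquiv.permCongr.injective).comp Equiv.Perm.sumCongrHom_injective

theorem exists_eq_directSum {τ : Equiv.Perm (Fin (a + b))}
    (h : ∀ i : Fin (a + b), (i : ℕ) < a → (τ i : ℕ) < a) : ∃ α β, τ = directSum α β := by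
  have hmaps : Set.MapsTo (finSumFinEquiv.symm.permCongr τ) (Set.range (Sum.inl : Fin a → _))
      (Set.range (Sum.inl : Fin a → Fin a ⊕ Fin b)) := by
    rintro _ ⟨i, rfl⟩
    refine ⟨⟨_, h (Fin.castAdd b i) i.isLt⟩, ?_⟩
    simp [Equiv.permCongr_apply, eq_comm, Equiv.symm_apply_eq]
  obtain ⟨⟨α, β⟩, hαβ⟩ := Equiv.Perm.mem_sumCongrHom_range_of_perm_mapsTo_inl hmaps
  exact ⟨α, β, (Equiv.symm_apply_eq _).1 hαβ.symm⟩

theorem directSum_mem_Av321_iff {α : Equiv.Perm (Fin a)} {β : Equiv.Perm (Fin b)} :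
    directSum α β ∈ Av321 (a + b) ↔ α ∈ Av321 a ∧ β ∈ Av321 b := by
  simp only [mem_Av321_iff]
  constructor
  · intro h
    refine ⟨fun i j k hij hjk hji hkj => h (Fin.castAdd b i) (Fin.castAdd b j) (Fin.castAdd b k)
      ?_ ?_ ?_ ?_, fun i j k hij hjk hji hkj =>
      h (Fin.natAdd a i) (Fin.natAdd a j) (Fin.natAdd a k) ?_ ?_ ?_ ?_⟩ <;> simpa
  · rintro ⟨hα, hβ⟩ i j k
    induction i using Fin.addCases <;> induction j using Fin.addCases <;>
      induction k using Fin.addCases <;>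
      simp only [directSum_castAdd, directSum_natAdd, Fin.lt_def, Fin.val_castAdd,
        Fin.val_natAdd, add_lt_add_iff_left] <;>
      first | exact hα _ _ _ | exact hβ _ _ _ | omega

/-- The set of fixed points of `τ`, as a set of natural numbers. -/
def fixedSet (τ : Equiv.Perm (Fin n)) : Finset ℕ :=
  (Finset.univ.filter fun i => τ i = i).map Fin.valEmbedding

theorem mem_fixedSet {τ : Equiv.Perm (Fin n)} {x : ℕ} :
    x ∈ fixedSet τ ↔ ∃ hx : x < n, τ ⟨x, hx⟩ = ⟨x, hx⟩ := by
  simp [fixedSet, Fin.exists_iff]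

theorem val_mem_fixedSet {τ : Equiv.Perm (Fin n)} {i : Fin n} :
    (i : ℕ) ∈ fixedSet τ ↔ τ i = i := by
  simp [mem_fixedSet]

theorem fixedSet_subset (τ : Equiv.Perm (Fin n)) : fixedSet τ ⊆ Finset.range n :=
  fun _ hx => Finset.mem_range.2 (mem_fixedSet.1 hx).1

theorem fixedSet_directSum (α : Equiv.Perm (Fin a)) (β : Equiv.Perm (Fin b)) :
    fixedSet (directSum α β) = fixedSet α ∪ (fixedSet β).map (addLeftEmbedding a) := by
  ext x
  simp only [Finset.mem_union, Finset.mem_map, addLeftEmbedding_apply]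
  constructor
  · intro hx
    obtain ⟨i, rfl⟩ : ∃ i : Fin (a + b), (i : ℕ) = x := ⟨⟨x, (mem_fixedSet.1 hx).1⟩, rfl⟩
    rw [val_mem_fixedSet] at hx
    induction i using Fin.addCases with
    | left i => exact .inl (val_mem_fixedSet.2 (by simpa using hx))
    | right i => exact .inr ⟨i, val_mem_fixedSet.2 (by simpa using hx), rfl⟩
  · rintro (hx | ⟨y, hy, rfl⟩)
    · obtain ⟨hxa, hx⟩ := mem_fixedSet.1 hx
      exact val_mem_fixedSet (i := Fin.castAdd b ⟨x, hxa⟩).2 (by rw [directSum_castAdd, hx])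
    · obtain ⟨hyb, hy⟩ := mem_fixedSet.1 hy
      exact val_mem_fixedSet (i := Fin.natAdd a ⟨y, hyb⟩).2 (by rw [directSum_natAdd, hy])

theorem apply_lt_of_lt_fixed {τ : Equiv.Perm (Fin n)} (hτ : τ ∈ Av321 n) {k : Fin n}
    (hk : τ k = k) {i : Fin n} (hi : i < k) : τ i < k := by
  have hne {j : Fin n} (hj : j ≠ k) : τ j ≠ k := fun h => hj (τ.injective (h.trans hk.symm))
  by_contra! hki
  have hmaps : ∀ j, k < j → k < τ j := by
    intro j hj
    by_contra! hjk
    refine mem_Av321_iff.1 hτ i k j hi hj ?_ ?_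
    · rw [hk]
      exact hki.lt_of_ne (hne hi.ne).symm
    · rw [hk]
      exact hjk.lt_of_ne (hne hj.ne')
  have hki' : k < τ.symm (τ i) :=
    Equiv.Perm.perm_symm_on_of_perm_on_finite (p := (k < ·)) hmaps (hki.lt_of_ne (hne hi.ne).symm)
  exact hi.not_gt (by simpa using hki')

theorem exists_eq_directSum_of_mem_fixedSet {τ : Equiv.Perm (Fin (a + b))}
    (hτ : τ ∈ Av321 (a + b)) (hf : f ∈ fixedSet τ) (ha : a = f ∨ a = f + 1) :
    ∃ α β, τ = directSum α β := by
  obtain ⟨hfn, hfix⟩ := mem_fixedSet.1 hf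
  refine exists_eq_directSum fun i hi => ?_
  rcases lt_or_ge (i : ℕ) f with hif | hif
  · have hlt : (τ i : ℕ) < f := apply_lt_of_lt_fixed hτ hfix hif
    omega
  · obtain rfl : i = ⟨f, hfn⟩ := Fin.ext (by simp only; omega)
    rwa [hfix]

theorem ncard_Av321_directSum {p : Equiv.Perm (Fin (a + b)) → Prop}
    {q : Equiv.Perm (Fin a) → Prop} {r : Equiv.Perm (Fin b) → Prop}
    (hp : ∀ τ ∈ Av321 (a + b), p τ → ∃ α β, τ = directSum α β)
    (hpqr : ∀ α β, p (directSum α β) ↔ q α ∧ r β) :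
    {τ | τ ∈ Av321 (a + b) ∧ p τ}.ncard =
      {α | α ∈ Av321 a ∧ q α}.ncard * {β | β ∈ Av321 b ∧ r β}.ncard := by
  rw [← Set.ncard_prod, ← Set.ncard_image_of_injective _ directSum_injective]
  congr 1
  ext τ
  constructor
  · rintro ⟨hτ, hpτ⟩
    obtain ⟨α, β, rfl⟩ := hp τ hτ hpτ
    have hαβ := directSum_mem_Av321_iff.1 hτ
    have hqr := (hpqr α β).1 hpτ
    exact ⟨(α, β), ⟨⟨hαβ.1, hqr.1⟩, ⟨hαβ.2, hqr.2⟩⟩, rfl⟩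
  · rintro ⟨⟨α, β⟩, ⟨⟨hα, hqα⟩, ⟨hβ, hrβ⟩⟩, rfl⟩
    exact ⟨directSum_mem_Av321_iff.2 ⟨hα, hβ⟩, (hpqr α β).2 ⟨hqα, hrβ⟩⟩

end DirectSum

section FixCount

variable {n a b : ℕ} {A B : Finset ℕ}

theorem union_map_addLeft_inj {A' B' : Finset ℕ} (hA : A ⊆ Finset.range a)
    (hA' : A' ⊆ Finset.range a) :
    A ∪ B.map (addLeftEmbedding a) = A' ∪ B'.map (addLeftEmbedding a) ↔ A = A' ∧ B = B' := by
  refine ⟨fun h => ?_, by rintro ⟨rfl, rfl⟩; rfl⟩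
  simp only [Finset.ext_iff, Finset.mem_union, Finset.mem_map, addLeftEmbedding_apply] at h
  simp only [Finset.subset_iff, Finset.mem_range] at hA hA'
  constructor <;> ext x
  · grind
  · grind [h (a + x)]

/-- The number of `321`-avoiding permutations of `Fin n` whose set of fixed points is `F`. -/
noncomputable def fixCount (n : ℕ) (F : Finset ℕ) : ℕ :=
  {τ : Equiv.Perm (Fin n) | τ ∈ Av321 n ∧ fixedSet τ = F}.ncard

/-- The number of `321`-avoiding derangements of `Fin n`. -/
noncomputable def fineNumber (n : ℕ) : ℕ := fixCount n ∅

theorem fixCount_union_map_addLeft {f : ℕ} (hA : A ⊆ Finset.range a)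
    (hf : f ∈ A ∪ B.map (addLeftEmbedding a)) (ha : a = f ∨ a = f + 1) :
    fixCount (a + b) (A ∪ B.map (addLeftEmbedding a)) = fixCount a A * fixCount b B := by
  refine ncard_Av321_directSum
    (fun τ hτ hτF => exists_eq_directSum_of_mem_fixedSet hτ (hτF ▸ hf) ha) fun α β => ?_
  rw [fixedSet_directSum, union_map_addLeft_inj (fixedSet_subset α) hA]

theorem fixCount_one_singleton_zero : fixCount 1 {0} = 1 := by
  have huniv : {τ : Equiv.Perm (Fin 1) | τ ∈ Av321 1 ∧ fixedSet τ = {0}} = Set.univ := by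
    refine Set.eq_univ_of_forall fun τ => ⟨mem_Av321_iff.2 fun i j k hij => by omega, ?_⟩
    ext x
    simp [mem_fixedSet, Subsingleton.elim _ (0 : Fin 1)]
  simp [fixCount, huniv]

theorem fixCount_insert_self (hA : A ⊆ Finset.range a) :
    fixCount (a + 1) (insert a A) = fixCount a A := by
  simpa [fixCount_one_singleton_zero, Finset.union_singleton] using
    fixCount_union_map_addLeft (b := 1) (B := {0}) hA (f := a) (by simp) (.inl rfl)

theorem fixCount_insert_last (hA : A ⊆ Finset.range a) :
    fixCount (a + 1 + b) (insert a A) = fixCount a A * fineNumber b := by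
  have hinsert : insert a A ⊆ Finset.range (a + 1) := by
    rw [Finset.range_add_one]
    exact Finset.insert_subset_insert a hA
  simpa [fixCount_insert_self hA, fineNumber] using
    fixCount_union_map_addLeft (b := b) (B := ∅) hinsert (f := a) (by simp) (.inr rfl)

theorem fixCount_insert_first :
    fixCount (a + 1 + b) (insert a (B.map (addLeftEmbedding (a + 1)))) =
      fineNumber a * fixCount b B := by
  have hempty : fixCount (a + 1) {a} = fineNumber a := fixCount_insert_self (Finset.empty_subset _)
  rw [← hempty, Finset.insert_eq]
  exact fixCount_union_map_addLeft (by simp) (f := a) (by simp) (.inr rfl)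

end FixCount

section Gaps

variable {n k : ℕ} {F : Finset ℕ}

/-- The set of positions with given successive gaps: the number of non-elements before the first
element, between the first two elements, and so on. -/
def gapSet : List ℕ → Finset ℕ
  | [] => ∅
  | g :: G => insert g ((gapSet G).map (addLeftEmbedding (g + 1)))

/-- The length of the initial segment occupied by `gapSet G` and its gaps. -/
def gapSpan : List ℕ → ℕ
  | [] => 0
  | g :: G => g + 1 + gapSpan G

theorem gapSet_subset (G : List ℕ) : gapSet G ⊆ Finset.range (gapSpan G) := by
  induction G with
  | nil => simp [gapSet]
  | cons g G ih =>
    simp only [Finset.subset_iff, Finset.mem_range] at ih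
    simp only [gapSet, gapSpan, Finset.subset_iff, Finset.mem_insert, Finset.mem_map,
      addLeftEmbedding_apply, Finset.mem_range]
    grind

theorem gapSet_surjective : Function.Surjective gapSet := by
  intro F
  induction hF : F.card using Nat.strong_induction_on generalizing F with
  | _ m ih =>
    rcases F.eq_empty_or_nonempty with rfl | hne
    · exact ⟨[], rfl⟩
    set g := F.min' hne
    have hcard : ((F.erase g).image (· - (g + 1))).card < m :=
      Finset.card_image_le.trans_lt (hF ▸ Finset.card_erase_lt_of_mem (F.min'_mem hne))
    obtain ⟨G, hG⟩ := ih _ hcard _ rfl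
    refine ⟨g :: G, ?_⟩
    ext x
    simp only [gapSet, hG, Finset.mem_insert, Finset.mem_map, Finset.mem_image, Finset.mem_erase,
      addLeftEmbedding_apply]
    have hg : g ∈ F := F.min'_mem hne
    have hle : ∀ y ∈ F, g ≤ y := F.min'_le
    constructor
    · rintro (rfl | ⟨_, ⟨y, ⟨hyg, hy⟩, rfl⟩, rfl⟩)
      · exact hg
      · rwa [Nat.add_sub_of_le (Nat.succ_le_of_lt ((hle y hy).lt_of_ne' hyg))]
    · intro hx
      refine or_iff_not_imp_left.2 fun hxg => ⟨x - (g + 1), ⟨x, ⟨hxg, hx⟩, rfl⟩, ?_⟩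
      exact Nat.add_sub_of_le (Nat.succ_le_of_lt ((hle x hx).lt_of_ne' hxg))

/-- The reflection of a set of positions in `{0, …, n - 1}`. -/
def revSet (n : ℕ) (F : Finset ℕ) : Finset ℕ := F.image fun x => n - 1 - x

theorem revSet_subset (hF : F ⊆ Finset.range n) : revSet n F ⊆ Finset.range n := by
  simp only [revSet, Finset.subset_iff, Finset.mem_image, Finset.mem_range] at hF ⊢
  grind

theorem revSet_revSet (hF : F ⊆ Finset.range n) : revSet n (revSet n F) = F := by
  simp only [Finset.subset_iff, Finset.mem_range] at hF
  rw [revSet, revSet, Finset.image_image]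
  refine (Finset.image_congr fun x hx => ?_).trans Finset.image_id
  have := hF hx
  simp only [Function.comp_apply, id_eq]
  omega

theorem revSet_add (hF : F ⊆ Finset.range n) :
    revSet (k + n) F = (revSet n F).map (addLeftEmbedding k) := by
  simp only [Finset.subset_iff, Finset.mem_range] at hF
  rw [revSet, revSet, Finset.map_eq_image, Finset.image_image]
  refine Finset.image_congr fun x hx => ?_
  have := hF hx
  simp only [Function.comp_apply, addLeftEmbedding_apply]
  omega

theorem revSet_gapSet_cons (h : ℕ) (H : List ℕ) :
    revSet (n + 1 + h) (gapSet (h :: H)) = insert n (revSet n (gapSet H)) := by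
  rw [gapSet, revSet, revSet, Finset.image_insert, Finset.map_eq_image, Finset.image_image]
  congr 1
  · omega
  · refine Finset.image_congr fun x _ => ?_
    simp only [Function.comp_apply, addLeftEmbedding_apply]
    omega

theorem fixCount_revSet_gapSet (H : List ℕ) (m : ℕ) :
    fixCount (gapSpan H + m) (revSet (gapSpan H + m) (gapSet H)) =
      (H.map fineNumber).prod * fineNumber m := by
  induction H with
  | nil => simp [gapSpan, gapSet, revSet, fineNumber]
  | cons h H ih =>
    have hsub : revSet (gapSpan H + m) (gapSet H) ⊆ Finset.range (gapSpan H + m) :=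
      revSet_subset ((gapSet_subset H).trans (Finset.range_mono (by omega)))
    rw [show gapSpan (h :: H) + m = gapSpan H + m + 1 + h by rw [gapSpan]; omega,
      revSet_gapSet_cons, fixCount_insert_last hsub, ih, List.map_cons, List.prod_cons]
    ring

theorem fixCount_gapSet_union_revSet (G H : List ℕ) (m : ℕ) :
    fixCount (gapSpan G + (gapSpan H + m))
      (gapSet G ∪ revSet (gapSpan G + (gapSpan H + m)) (gapSet H)) =
      (G.map fineNumber).prod * (H.map fineNumber).prod * fineNumber m := by
  induction G with
  | nil => simp [gapSpan, gapSet, fixCount_revSet_gapSet]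
  | cons g G ih =>
    have hH : gapSet H ⊆ Finset.range (gapSpan G + (gapSpan H + m)) :=
      (gapSet_subset H).trans (Finset.range_mono (by omega))
    rw [gapSpan, add_assoc (g + 1), revSet_add hH, gapSet, Finset.insert_union, ← Finset.map_union,
      fixCount_insert_first, ih, List.map_cons, List.prod_cons]
    ring

end Gaps

/-! ### Fine numbers -/

section FineNumbers

theorem ncard_eq_ncard_eq_empty_add_sum_ncard_min {α : Type*} [Finite α] {n : ℕ}
    {F : α → Finset ℕ} (hF : ∀ x, F x ⊆ Finset.range n) (S : Set α) :
    S.ncard = {x | x ∈ S ∧ F x = ∅}.ncard +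
      ∑ f ∈ Finset.range n, {x | x ∈ S ∧ (F x).min = f}.ncard := by
  classical
  have := Fintype.ofFinite α
  have hmem : ∀ x ∈ S.toFinset, (F x).min ∈ Finset.insertNone (Finset.range n) := by
    intro x _
    refine Finset.mem_insertNone.2 fun f hf => hF x (Finset.mem_of_min hf)
  rw [Set.ncard_eq_toFinset_card', Finset.card_eq_sum_card_fiberwise hmem, Finset.sum_insertNone]
  congr 1
  · rw [Set.ncard_eq_toFinset_card']
    congr 1
    ext x
    simp only [Finset.mem_filter, Set.mem_toFinset, Set.mem_ofPred_eq, ← Finset.min_eq_top]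
    rfl
  · refine Finset.sum_congr rfl fun f _ => ?_
    rw [Set.ncard_eq_toFinset_card']
    congr 1
    ext x
    simp only [Finset.mem_filter, Set.mem_toFinset, Set.mem_ofPred_eq]
    rfl

theorem min_union_map_addLeft_eq_iff {f : ℕ} {A B : Finset ℕ} (hA : A ⊆ Finset.range (f + 1)) :
    (A ∪ B.map (addLeftEmbedding (f + 1))).min = f ↔ A = {f} := by
  constructor
  · intro h
    have hf := Finset.mem_of_min h
    have hle := fun x hx => Finset.min_le_of_eq (b := x) hx h
    simp only [Finset.subset_iff, Finset.mem_range] at hA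
    simp only [Finset.mem_union, Finset.mem_map, addLeftEmbedding_apply] at hf hle
    ext x
    grind
  · rintro rfl
    refine le_antisymm (Finset.min_le (by simp)) (Finset.le_min fun x hx => ?_)
    simp only [Finset.mem_union, Finset.mem_singleton, Finset.mem_map, addLeftEmbedding_apply] at hx
    exact WithTop.coe_le_coe.2 (by grind)

theorem ncard_Av321_fixedSet_min_eq (f b : ℕ) :
    {τ | τ ∈ Av321 (f + 1 + b) ∧ (fixedSet τ).min = f}.ncard = fineNumber f * catalan b := by
  have h := ncard_Av321_directSum (a := f + 1) (b := b) (p := fun τ => (fixedSet τ).min = f)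
    (q := fun α => fixedSet α = {f}) (r := fun _ => True)
    (fun τ hτ hmin => exists_eq_directSum_of_mem_fixedSet hτ (Finset.mem_of_min hmin) (.inr rfl))
    fun α β => by
      rw [fixedSet_directSum, min_union_map_addLeft_eq_iff (fixedSet_subset α), and_true]
  rw [h]
  simp only [and_true, Set.ofPred_mem_eq, ncard_Av321]
  congr 1
  exact fixCount_insert_self (Finset.empty_subset _)

theorem fineNumber_zero : fineNumber 0 = 1 := by
  have hfix (τ : Equiv.Perm (Fin 0)) : fixedSet τ = ∅ := Finset.subset_empty.1 (fixedSet_subset τ)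
  simp only [fineNumber, fixCount, hfix, and_true, Set.ofPred_mem_eq, ncard_Av321, catalan_zero]

theorem catalan_succ_eq_fineNumber_add (n : ℕ) :
    catalan (n + 1) = fineNumber (n + 1) +
      ∑ p ∈ Finset.HasAntidiagonal.antidiagonal n, fineNumber p.1 * catalan p.2 := by
  rw [← ncard_Av321, ncard_eq_ncard_eq_empty_add_sum_ncard_min fixedSet_subset,
    Finset.Nat.sum_antidiagonal_eq_sum_range_succ (fun i j => fineNumber i * catalan j)]
  congr 1
  refine Finset.sum_congr rfl fun f hf => ?_
  obtain ⟨b, rfl⟩ := Nat.exists_eq_add_of_le (Nat.lt_succ_iff.1 (Finset.mem_range.1 hf))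
  rw [Nat.add_sub_cancel_left, ← ncard_Av321_fixedSet_min_eq, add_right_comm]

open PowerSeries (X catalanSeries)

/-- The ordinary generating function of the Fine numbers. -/
noncomputable def fineSeries : PowerSeries ℕ := PowerSeries.mk fineNumber

theorem catalanSeries_eq_fineSeries_add :
    catalanSeries = fineSeries + X * fineSeries * catalanSeries := by
  ext n
  rcases n with _ | n
  · simp [fineSeries, fineNumber_zero]
  · rw [map_add, mul_assoc, PowerSeries.coeff_succ_X_mul, PowerSeries.coeff_mul]
    simpa [fineSeries] using catalan_succ_eq_fineNumber_add n

theorem two_add_X_mul_fineSeries : (2 + X) * fineSeries = catalanSeries + 1 := by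
  apply PowerSeries.map_injective (Nat.castRingHom ℤ) Nat.cast_injective
  have hC := congrArg (PowerSeries.map (Nat.castRingHom ℤ))
    PowerSeries.catalanSeries_sq_mul_X_add_one
  have hF := congrArg (PowerSeries.map (Nat.castRingHom ℤ)) catalanSeries_eq_fineSeries_add
  simp only [map_add, map_mul, map_pow, map_one, map_ofNat, PowerSeries.map_X] at hC hF ⊢
  set C := PowerSeries.map (Nat.castRingHom ℤ) catalanSeries
  have hne : 1 + X * C ≠ 0 := fun h => by
    simpa using congrArg PowerSeries.constantCoeff h
  apply mul_left_cancel₀ hne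
  linear_combination (-(2 + X)) * hF - hC

theorem fineSeries_eq_one_add : fineSeries = 1 + X * (X * (catalanSeries ^ 2 * fineSeries)) := by
  apply PowerSeries.map_injective (Nat.castRingHom ℤ) Nat.cast_injective
  have hC := congrArg (PowerSeries.map (Nat.castRingHom ℤ))
    PowerSeries.catalanSeries_sq_mul_X_add_one
  have hF := congrArg (PowerSeries.map (Nat.castRingHom ℤ)) catalanSeries_eq_fineSeries_add
  simp only [map_add, map_mul, map_pow, map_one, PowerSeries.map_X] at hC hF ⊢
  set C := PowerSeries.map (Nat.castRingHom ℤ) catalanSeries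
  linear_combination (X * C - 1) * hF - hC

theorem catalan_succ_eq_fineNumber (n : ℕ) :
    catalan (n + 1) = 2 * fineNumber (n + 1) + fineNumber n := by
  have h := congrArg (PowerSeries.coeff (n + 1)) two_add_X_mul_fineSeries
  rw [add_mul, map_add, PowerSeries.coeff_succ_X_mul, two_mul, map_add] at h
  simpa [fineSeries, PowerSeries.coeff_one, two_mul] using h.symm

theorem fineNumber_succ (g : ℕ) : fineNumber (g + 1) =
    ∑ i ∈ Finset.range g, catalan (i + 1) * fineNumber (g - 1 - i) := by
  have h := congrArg (PowerSeries.coeff (g + 1)) fineSeries_eq_one_add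
  rw [map_add, PowerSeries.coeff_succ_X_mul] at h
  rcases g with _ | g
  · simpa [fineSeries] using h
  · have hsq (i : ℕ) : PowerSeries.coeff i (catalanSeries ^ 2) = catalan (i + 1) := by
      rw [sq, PowerSeries.coeff_mul, catalan_succ']
      simp
    rw [PowerSeries.coeff_succ_X_mul, PowerSeries.coeff_mul,
      Finset.Nat.sum_antidiagonal_eq_sum_range_succ_mk] at h
    simpa [fineSeries, hsq, PowerSeries.coeff_one] using h

end FineNumbers

section Asymptotics

open Topology

theorem tendsto_zero_of_le_mul_add {a e : ℕ → ℝ} {r : ℝ} (ha : ∀ n, 0 ≤ a n) (hr0 : 0 ≤ r)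
    (hr1 : r < 1) (hae : ∀ᶠ n in atTop, a (n + 1) ≤ r * a n + e n)
    (he : Tendsto e atTop (𝓝 0)) : Tendsto a atTop (𝓝 0) := by
  refine tendsto_order.2 ⟨fun c hc => .of_forall fun n => hc.trans_le (ha n), fun ε hε => ?_⟩
  have hsmall : 0 < (1 - r) * (ε / 2) := mul_pos (sub_pos.2 hr1) (half_pos hε)
  obtain ⟨N, hN⟩ := eventually_atTop.1 (hae.and (he.eventually_lt_const hsmall))
  have hgeom : ∀ k, a (N + k) ≤ r ^ k * a N + ε / 2 := by
    intro k
    induction k with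
    | zero => simpa using (half_pos hε).le
    | succ k ih =>
      obtain ⟨hle, hlt⟩ := hN (N + k) (Nat.le_add_right N k)
      rw [← add_assoc, pow_succ]
      nlinarith [mul_le_mul_of_nonneg_left ih hr0]
  have hlim : Tendsto (fun k => r ^ k * a N + ε / 2) atTop (𝓝 (ε / 2)) := by
    simpa using ((tendsto_pow_atTop_nhds_zero_of_lt_one hr0 hr1).mul_const (a N)).add_const (ε / 2)
  obtain ⟨K, hK⟩ := eventually_atTop.1 (hlim.eventually_lt_const (half_lt_self hε))
  filter_upwards [eventually_ge_atTop (N + K)] with n hn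
  obtain ⟨k, rfl⟩ := Nat.exists_eq_add_of_le (Nat.le_of_add_right_le hn)
  exact (hgeom k).trans_lt (hK k (by omega))

theorem tendsto_div_one_sub_of_eq_add_mul {x p q : ℕ → ℝ} {p' q' : ℝ}
    (hx : ∀ n, x (n + 1) = p n + q n * x n) (hp : Tendsto p atTop (𝓝 p'))
    (hq : Tendsto q atTop (𝓝 q')) (hq' : |q'| < 1) : Tendsto x atTop (𝓝 (p' / (1 - q'))) := by
  set L := p' / (1 - q')
  have hL : p' + q' * L - L = 0 := by
    have : 1 - q' ≠ 0 := (sub_pos.2 (abs_lt.1 hq').2).ne'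
    simp only [L]
    field_simp
    ring
  obtain ⟨r, hqr, hr⟩ := exists_between hq'
  have he : Tendsto (fun n => |p n + q n * L - L|) atTop (𝓝 0) := by
    simpa [hL] using ((hp.add (hq.mul_const L)).sub_const L).abs
  rw [tendsto_iff_norm_sub_tendsto_zero]
  refine tendsto_zero_of_le_mul_add (fun n => norm_nonneg _) ((abs_nonneg q').trans hqr.le) hr
    ?_ he
  filter_upwards [hq.abs.eventually_lt_const hqr] with n hn
  calc ‖x (n + 1) - L‖ = |q n * (x n - L) + (p n + q n * L - L)| := by
        rw [hx, Real.norm_eq_abs]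
        ring_nf
    _ ≤ |q n| * |x n - L| + |p n + q n * L - L| := (abs_add_le _ _).trans_eq (by rw [abs_mul])
    _ ≤ r * ‖x n - L‖ + |p n + q n * L - L| := by
        rw [Real.norm_eq_abs]
        gcongr

theorem add_two_mul_catalan_succ (n : ℕ) : (n + 2) * catalan (n + 1) = (4 * n + 2) * catalan n := by
  have h := Nat.succ_mul_centralBinom_succ n
  rw [← succ_mul_catalan_eq_centralBinom, ← succ_mul_catalan_eq_centralBinom] at h
  refine Nat.eq_of_mul_eq_mul_left n.succ_pos ?_
  linarith

theorem catalan_pos (n : ℕ) : 0 < catalan n := by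
  have h := succ_mul_catalan_eq_centralBinom n ▸ Nat.centralBinom_pos n
  exact Nat.pos_of_mul_pos_left h

theorem catalan_div_catalan_succ (n : ℕ) :
    (catalan n : ℝ) / catalan (n + 1) = (n + 2) / (4 * n + 2) := by
  have hpos : (0 : ℝ) < catalan (n + 1) := mod_cast catalan_pos _
  rw [div_eq_div_iff hpos.ne' (by positivity), mul_comm]
  exact_mod_cast (add_two_mul_catalan_succ n).symm

theorem tendsto_catalan_div_catalan_succ :
    Tendsto (fun n : ℕ => (catalan n : ℝ) / catalan (n + 1)) atTop (𝓝 4⁻¹) := by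
  have hlim : Tendsto (fun n : ℕ => (4⁻¹ : ℝ) + 3 / 8 * ((n : ℝ) + 1 / 2)⁻¹) atTop (𝓝 4⁻¹) := by
    have hinv := tendsto_inv_atTop_zero.comp
      (tendsto_atTop_add_const_right _ (1 / 2 : ℝ) tendsto_natCast_atTop_atTop)
    simpa using (hinv.const_mul (3 / 8 : ℝ)).const_add 4⁻¹
  refine hlim.congr fun n => ?_
  rw [catalan_div_catalan_succ]
  field_simp
  ring

theorem tendsto_fineNumber_div_catalan :
    Tendsto (fun n : ℕ => (fineNumber n : ℝ) / catalan n) atTop (𝓝 (4 / 9)) := by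
  have hrec (n : ℕ) : (fineNumber (n + 1) : ℝ) / catalan (n + 1) =
      2⁻¹ + (catalan n / catalan (n + 1) : ℝ) * -2⁻¹ * (fineNumber n / catalan n) := by
    have hC (m : ℕ) : (catalan m : ℝ) ≠ 0 := mod_cast (catalan_pos m).ne'
    have hF : (catalan (n + 1) : ℝ) = 2 * fineNumber (n + 1) + fineNumber n :=
      mod_cast catalan_succ_eq_fineNumber n
    have := hC n
    have := hC (n + 1)
    field_simp
    linarith
  have hlim := tendsto_div_one_sub_of_eq_add_mul
    (x := fun n : ℕ => (fineNumber n : ℝ) / catalan n) hrec tendsto_const_nhds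
    (tendsto_catalan_div_catalan_succ.mul_const (-2⁻¹)) (by norm_num [abs_lt])
  norm_num at hlim
  exact hlim

theorem tendsto_catalan_div_catalan_add (k : ℕ) :
    Tendsto (fun n : ℕ => (catalan n : ℝ) / catalan (k + n)) atTop (𝓝 (4⁻¹ ^ k)) := by
  have hC (n : ℕ) : (catalan n : ℝ) ≠ 0 := mod_cast (catalan_pos n).ne'
  induction k with
  | zero => simp [hC]
  | succ k ih =>
    rw [pow_succ]
    refine (ih.mul ((tendsto_add_atTop_iff_nat k).2 tendsto_catalan_div_catalan_succ)).congr
      fun n => ?_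
    rw [show k + 1 + n = n + k + 1 by ring, add_comm k n, div_mul_div_cancel₀ (hC _)]

theorem tendsto_fineNumber_div_catalan_add (k : ℕ) :
    Tendsto (fun n : ℕ => (fineNumber n : ℝ) / catalan (k + n)) atTop
      (𝓝 (4 / 9 * 4⁻¹ ^ k)) := by
  have hC (n : ℕ) : (catalan n : ℝ) ≠ 0 := mod_cast (catalan_pos n).ne'
  refine (tendsto_fineNumber_div_catalan.mul (tendsto_catalan_div_catalan_add k)).congr fun n => ?_
  rw [div_mul_div_cancel₀ (hC _)]

theorem sum_range_catalan_mul_pow (n : ℕ) :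
    ∑ i ∈ Finset.range n, (catalan i : ℝ) * 4⁻¹ ^ i = 2 - 2 * (n + 1) * catalan n * 4⁻¹ ^ n := by
  induction n with
  | zero => simp
  | succ n ih =>
    have h : (n + 2 : ℝ) * catalan (n + 1) = (4 * n + 2) * catalan n :=
      mod_cast add_two_mul_catalan_succ n
    rw [Finset.sum_range_succ, ih]
    push_cast
    rw [pow_succ]
    linear_combination (2 * 4⁻¹ * (4⁻¹ : ℝ) ^ n) * h

theorem summable_catalan_mul_pow : Summable fun n : ℕ => (catalan n : ℝ) * 4⁻¹ ^ n := by
  refine summable_of_sum_range_le (c := 2) (fun n => by positivity) fun n => ?_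
  rw [sum_range_catalan_mul_pow]
  exact sub_le_self _ (by positivity)

theorem hasSum_catalan_mul_pow : HasSum (fun n : ℕ => (catalan n : ℝ) * 4⁻¹ ^ n) 2 := by
  have hsum := summable_catalan_mul_pow
  set S := ∑' n : ℕ, (catalan n : ℝ) * 4⁻¹ ^ n with hS
  have hquad : S = 1 + S * S * 4⁻¹ := by
    rw [hS, tsum_mul_tsum_eq_tsum_sum_antidiagonal_of_summable_norm
      hsum.norm hsum.norm, ← tsum_mul_right, hsum.tsum_eq_zero_add]
    congr 1
    · simp
    · refine tsum_congr fun n => ?_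
      rw [catalan_succ', Nat.cast_sum, Finset.sum_mul, Finset.sum_mul]
      refine Finset.sum_congr rfl fun p hp => ?_
      rw [← Finset.HasAntidiagonal.mem_antidiagonal.1 hp, pow_succ, pow_add, Nat.cast_mul]
      ring
  have hS2 : S = 2 := by nlinarith [sq_nonneg (S - 2)]
  exact hS2 ▸ hsum.hasSum

theorem tsum_catalan_mul_pow : ∑' n : ℕ, (catalan n : ℝ≥0∞) * 4⁻¹ ^ n = 2 := by
  have h := hasSum_catalan_mul_pow
  have hreal := ENNReal.ofReal_tsum_of_nonneg (fun n => by positivity) h.summable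
  rw [h.tsum_eq, ENNReal.ofReal_ofNat] at hreal
  rw [hreal]
  refine tsum_congr fun n => ?_
  rw [ENNReal.ofReal_mul (by positivity), ENNReal.ofReal_natCast,
    ENNReal.ofReal_pow (by positivity), ENNReal.ofReal_inv_of_pos (by positivity),
    ENNReal.ofReal_ofNat]

end Asymptotics

/-! ### The size of a Galton–Watson tree -/

section Words

/-- The embedding of words that raises the first letter by one, so that the branches at the root
of a tree make room for a new first branch. -/
def succHead : List ℕ+ → List ℕ+
  | [] => []
  | i :: u => (i + 1) :: u

@[simp]
theorem succHead_nil : succHead [] = [] := rfl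

@[simp]
theorem succHead_cons (i : ℕ+) (u : List ℕ+) : succHead (i :: u) = (i + 1) :: u := rfl

theorem succHead_injective : Function.Injective succHead := by
  rintro (_ | ⟨i, u⟩) (_ | ⟨j, v⟩) h <;> simp_all

theorem pnat_one_ne_add_one (i : ℕ+) : 1 ≠ i + 1 := (PNat.lt_add_left 1 i).ne

theorem one_cons_ne_succHead (u v : List ℕ+) : 1 :: u ≠ succHead v := by
  rcases v with _ | ⟨j, v⟩ <;> simp [pnat_one_ne_add_one]

@[elab_as_elim]
theorem word_cases {P : List ℕ+ → Prop} (nil : P []) (one_cons : ∀ u, P (1 :: u))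
    (succ_cons : ∀ i u, P ((i + 1) :: u)) (w : List ℕ+) : P w := by
  rcases w with _ | ⟨i, u⟩
  · exact nil
  · induction i using PNat.recOn with
    | one => exact one_cons u
    | succ i => exact succ_cons i u

/-- The words of the tree whose first branch at the root consists of the words in `A` and whose
remaining branches are those of `B`. -/
def joinWords (A B : Set (List ℕ+)) : Set (List ℕ+) := List.cons 1 '' A ∪ succHead '' B

variable {A B : Set (List ℕ+)}

theorem disjoint_image_cons_one_image_succHead (A B : Set (List ℕ+)) :
    Disjoint (List.cons 1 '' A) (succHead '' B) := by
  rw [Set.disjoint_left]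
  rintro _ ⟨u, _, rfl⟩ ⟨v, _, h⟩
  exact one_cons_ne_succHead u v h.symm

@[simp]
theorem one_cons_mem_joinWords {u : List ℕ+} : 1 :: u ∈ joinWords A B ↔ u ∈ A := by
  simp [joinWords, (one_cons_ne_succHead _ _).symm]

theorem succHead_mem_joinWords {u : List ℕ+} : succHead u ∈ joinWords A B ↔ u ∈ B := by
  simp [joinWords, one_cons_ne_succHead, succHead_injective.eq_iff]

@[simp]
theorem nil_mem_joinWords : [] ∈ joinWords A B ↔ [] ∈ B := succHead_mem_joinWords (u := [])

@[simp]
theorem succ_cons_mem_joinWords {u : List ℕ+} {i : ℕ+} :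
    (i + 1) :: u ∈ joinWords A B ↔ i :: u ∈ B := succHead_mem_joinWords (u := i :: u)

end Words

namespace OrderedTree

theorem append_mem_iff (t : OrderedTree) (u : List ℕ+) (i : ℕ+) :
    u ++ [i] ∈ t.verts ↔ (i : ℕ) ≤ t.numChildren u := by
  have hfin := (t.locallyFinite u).image (fun i : ℕ+ => (i : ℕ))
  refine ⟨fun h => le_csSup hfin.bddAbove ⟨i, h, rfl⟩, fun h => ?_⟩
  have hne : ((fun i : ℕ+ => (i : ℕ)) '' {i : ℕ+ | u ++ [i] ∈ t.verts}).Nonempty := by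
    by_contra hempty
    rw [numChildren, Set.not_nonempty_iff_eq_empty.1 hempty, csSup_empty] at h
    exact i.pos.not_ge h
  obtain ⟨j, hj, hsup⟩ := hne.csSup_mem hfin
  exact t.sibling_mem u j i hj (PNat.coe_le_coe _ _ |>.1 (h.trans_eq hsup.symm))

theorem numChildren_eq_of_forall {t : OrderedTree} {u : List ℕ+} {k : ℕ}
    (h : ∀ i : ℕ+, u ++ [i] ∈ t.verts ↔ (i : ℕ) ≤ k) : t.numChildren u = k := by
  refine eq_of_forall_le_iff fun i => ?_
  rcases i.eq_zero_or_pos with rfl | hi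
  · simp
  · exact (append_mem_iff t u ⟨i, hi⟩).symm.trans (h ⟨i, hi⟩)

section Join

/-- The tree with a single vertex. -/
def single : OrderedTree where
  verts := {[]}
  root_mem := rfl
  ancestor_mem v w h := by simp_all
  sibling_mem u i j h := by simp at h
  locallyFinite u := by simp

/-- The tree whose first branch at the root is `a` and whose remaining branches are those of
`b`. -/
def join (a b : OrderedTree) : OrderedTree where
  verts := joinWords a.verts b.verts
  root_mem := nil_mem_joinWords.2 b.root_mem
  ancestor_mem v w h := by
    induction v using word_cases with
    | nil => exact nil_mem_joinWords.2 b.root_mem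
    | one_cons v => exact one_cons_mem_joinWords.2 (a.ancestor_mem v w (by simpa using h))
    | succ_cons k v =>
      exact succ_cons_mem_joinWords.2 (b.ancestor_mem (k :: v) w (by simpa using h))
  sibling_mem u i j h hji := by
    induction u using word_cases with
    | nil =>
      induction j using PNat.recOn with
      | one => exact one_cons_mem_joinWords.2 a.root_mem
      | succ j =>
        induction i using PNat.recOn with
        | one => exact absurd hji (PNat.lt_add_left 1 j).not_ge
        | succ i =>
          exact succ_cons_mem_joinWords.2
            (b.sibling_mem [] i j (by simpa using h) (by simpa using hji))
    | one_cons u => exact one_cons_mem_joinWords.2 (a.sibling_mem u i j (by simpa using h) hji)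
    | succ_cons k u =>
      exact succ_cons_mem_joinWords.2 (b.sibling_mem (k :: u) i j (by simpa using h) hji)
  locallyFinite u := by
    induction u using word_cases with
    | nil =>
      refine (((b.locallyFinite []).image (· + 1)).insert 1).subset fun i hi => ?_
      induction i using PNat.recOn with
      | one => exact Set.mem_insert _ _
      | succ i => exact Set.mem_insert_of_mem _ ⟨i, succ_cons_mem_joinWords.1 hi, rfl⟩
    | one_cons u => simpa using a.locallyFinite u
    | succ_cons k u => simpa using b.locallyFinite (k :: u)

theorem verts_join (a b : OrderedTree) : (join a b).verts = joinWords a.verts b.verts := rfl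

/-- The subtree above the first child of the root. -/
def firstBranch (t : OrderedTree) (h : [1] ∈ t.verts) : OrderedTree where
  verts := {u | 1 :: u ∈ t.verts}
  root_mem := h
  ancestor_mem v := t.ancestor_mem (1 :: v)
  sibling_mem u := t.sibling_mem (1 :: u)
  locallyFinite u := t.locallyFinite (1 :: u)

/-- The tree obtained by deleting the first branch at the root. -/
def laterBranches (t : OrderedTree) : OrderedTree where
  verts := {w | succHead w ∈ t.verts}
  root_mem := t.root_mem
  ancestor_mem
    | [], _, _ => t.root_mem
    | i :: v, w, h => t.ancestor_mem ((i + 1) :: v) w h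
  sibling_mem
    | [], i, j, h, hji => t.sibling_mem [] (i + 1) (j + 1) h (by simpa using hji)
    | k :: u, i, j, h, hji => t.sibling_mem ((k + 1) :: u) i j h hji
  locallyFinite
    | [] => Set.Finite.preimage (f := (· + 1)) (add_left_injective 1).injOn (t.locallyFinite [])
    | k :: u => t.locallyFinite ((k + 1) :: u)

theorem join_firstBranch_laterBranches (t : OrderedTree) (h : [1] ∈ t.verts) :
    join (t.firstBranch h) t.laterBranches = t := by
  ext w
  induction w using word_cases with
  | nil => exact iff_of_true (join _ _).root_mem t.root_mem
  | one_cons u => exact one_cons_mem_joinWords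
  | succ_cons k u => exact succ_cons_mem_joinWords (B := t.laterBranches.verts)

theorem join_injective {a b a' b' : OrderedTree} (h : join a b = join a' b') :
    a = a' ∧ b = b' := by
  have hverts : joinWords a.verts b.verts = joinWords a'.verts b'.verts := congrArg verts h
  constructor
  · ext u
    rw [← one_cons_mem_joinWords (B := b.verts), hverts, one_cons_mem_joinWords]
  · ext u
    rw [← succHead_mem_joinWords (A := a.verts), hverts, succHead_mem_joinWords]

theorem one_mem_join (a b : OrderedTree) : [1] ∈ (join a b).verts :=
  one_cons_mem_joinWords.2 a.root_mem

theorem single_ne_join (a b : OrderedTree) : single ≠ join a b := fun h =>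
  absurd (h ▸ one_mem_join a b : [1] ∈ single.verts) (by simp [single])

theorem eq_single_or_one_mem (t : OrderedTree) : t = single ∨ [1] ∈ t.verts := by
  refine or_iff_not_imp_right.2 fun h => OrderedTree.ext (Set.ext fun w => ?_)
  rcases w with _ | ⟨i, u⟩
  · exact iff_of_true t.root_mem rfl
  · exact iff_of_false (fun hu => h (t.sibling_mem [] i 1 (t.ancestor_mem [i] u hu) one_le))
      (List.cons_ne_nil i u)

theorem eq_single_or_eq_join (t : OrderedTree) : t = single ∨ ∃ a b, t = join a b :=
  t.eq_single_or_one_mem.imp_right fun h =>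
    ⟨t.firstBranch h, t.laterBranches, (t.join_firstBranch_laterBranches h).symm⟩

theorem numChildren_join_cons (a b : OrderedTree) (u : List ℕ+) :
    (join a b).numChildren (1 :: u) = a.numChildren u :=
  numChildren_eq_of_forall fun i => by
    rw [List.cons_append, verts_join, one_cons_mem_joinWords, append_mem_iff]

theorem numChildren_join_nil (a b : OrderedTree) :
    (join a b).numChildren [] = b.numChildren [] + 1 :=
  numChildren_eq_of_forall fun i => by
    induction i using PNat.recOn with
    | one => simp [verts_join, a.root_mem]
    | succ i => simpa [verts_join] using append_mem_iff b [] i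

theorem numChildren_join_succHead (a b : OrderedTree) {u : List ℕ+} (hu : u ≠ []) :
    (join a b).numChildren (succHead u) = b.numChildren u :=
  numChildren_eq_of_forall fun i => by
    obtain ⟨k, v, rfl⟩ := List.exists_cons_of_ne_nil hu
    simpa [verts_join] using append_mem_iff b (k :: v) i

theorem numChildren_single : single.numChildren [] = 0 :=
  numChildren_eq_of_forall fun i => by simp [single]

end Join

section Size

theorem size_single : single.size = 1 := Set.encard_singleton _

theorem size_join (a b : OrderedTree) : (join a b).size = a.size + b.size := by
  rw [size, verts_join, joinWords,
    Set.encard_union_eq (disjoint_image_cons_one_image_succHead _ _),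
    List.cons_injective.encard_image, succHead_injective.encard_image, size, size]

theorem size_ne_zero (t : OrderedTree) : t.size ≠ 0 :=
  Set.encard_ne_zero.2 ⟨[], t.root_mem⟩

/-- The number of vertices as a natural number, with value zero for infinite trees. -/
noncomputable def natSize (t : OrderedTree) : ℕ := t.size.toNat

theorem natSize_eq_iff {n : ℕ} (hn : n ≠ 0) (t : OrderedTree) : t.natSize = n ↔ t.size = n :=
  ENat.toNat_eq_iff hn

end Size

section Binary

/-- The finite ordered tree encoded by a binary tree under the left-child right-sibling
correspondence: the left subtree encodes the first branch at the root, the right subtree the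
remaining ones. -/
def ofBinary : BinaryTree Unit → OrderedTree
  | .nil => single
  | .node _ l r => join (ofBinary l) (ofBinary r)

theorem size_ofBinary (x : BinaryTree Unit) : (ofBinary x).size = (x.numNodes + 1 : ℕ) := by
  induction x with
  | nil => exact size_single
  | node _ l r hl hr =>
    rw [ofBinary, size_join, hl, hr, BinaryTree.numNodes, ← Nat.cast_add]
    congr 1
    ring

theorem ofBinary_injective : Function.Injective ofBinary := by
  intro x
  induction x with
  | nil =>
    rintro (_ | ⟨_, l, r⟩) h
    · rfl
    · exact absurd h (single_ne_join _ _)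
  | node _ l r hl hr =>
    rintro (_ | ⟨_, l', r'⟩) h
    · exact absurd h.symm (single_ne_join _ _)
    · obtain ⟨hleft, hright⟩ := join_injective h
      rw [hl hleft, hr hright]

theorem exists_ofBinary_eq (n : ℕ) {t : OrderedTree} (h : t.size ≤ n) :
    ∃ x, ofBinary x = t := by
  induction n generalizing t with
  | zero => exact absurd (le_zero_iff.1 h) t.size_ne_zero
  | succ n ih =>
    rcases eq_single_or_eq_join t with rfl | ⟨a, b, rfl⟩
    · exact ⟨.nil, rfl⟩
    · rw [size_join, Nat.cast_succ] at h
      have ha : a.size ≤ n := (ENat.add_le_add_iff_right ENat.one_ne_top).1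
        ((add_le_add_right (Order.one_le_iff_ne_zero.2 b.size_ne_zero) _).trans h)
      have hb : b.size ≤ n := (ENat.add_le_add_iff_left ENat.one_ne_top).1
        ((add_le_add_left (Order.one_le_iff_ne_zero.2 a.size_ne_zero) _).trans
          (h.trans_eq (add_comm _ _)))
      obtain ⟨x, rfl⟩ := ih ha
      obtain ⟨y, rfl⟩ := ih hb
      exact ⟨.node () x y, rfl⟩

theorem setOf_natSize_eq (n : ℕ) : {t : OrderedTree | t.natSize = n + 1} =
    ((BinaryTree.treesOfNumNodesEq n).map ⟨ofBinary, ofBinary_injective⟩ :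
      Finset OrderedTree) := by
  ext t
  simp only [Set.mem_ofPred_eq, natSize_eq_iff n.succ_ne_zero, Finset.coe_map,
    Function.Embedding.coeFn_mk, Set.mem_image, Finset.mem_coe, BinaryTree.mem_treesOfNumNodesEq]
  constructor
  · intro h
    obtain ⟨x, rfl⟩ := exists_ofBinary_eq _ h.le
    rw [size_ofBinary, Nat.cast_inj] at h
    exact ⟨x, Nat.succ_injective h, rfl⟩
  · rintro ⟨x, rfl, rfl⟩
    exact size_ofBinary x

end Binary

section Weight

theorem geomHalf_apply (n : ℕ) : geomHalf n = (2⁻¹ : ℝ≥0∞) ^ (n + 1) := rfl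

theorem finite_verts_ofBinary (x : BinaryTree Unit) : (ofBinary x).verts.Finite :=
  Set.encard_ne_top_iff.1 ((size_ofBinary x).trans_ne (ENat.natCast_ne_top _))

theorem finprod_geomHalf_join {a b : OrderedTree} (ha : a.verts.Finite) (hb : b.verts.Finite) :
    ∏ᶠ u ∈ (join a b).verts, geomHalf ((join a b).numChildren u) =
      (∏ᶠ u ∈ a.verts, geomHalf (a.numChildren u)) *
        (2⁻¹ * ∏ᶠ u ∈ b.verts, geomHalf (b.numChildren u)) := by
  have hroot : insert [] (b.verts \ {[]}) = b.verts := by simp [b.root_mem]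
  rw [verts_join, joinWords, finprod_mem_union (disjoint_image_cons_one_image_succHead _ _)
    (ha.image _) (hb.image _), finprod_mem_image List.cons_injective.injOn,
    finprod_mem_image succHead_injective.injOn]
  congr 1
  · simp only [numChildren_join_cons]
  · rw [← hroot, finprod_mem_insert _ (by simp) hb.sdiff, finprod_mem_insert _ (by simp) hb.sdiff,
      succHead_nil, numChildren_join_nil, geomHalf_apply, pow_succ', mul_assoc, ← geomHalf_apply]
    congr 2
    exact finprod_mem_congr rfl fun u hu => by rw [numChildren_join_succHead a b hu.2]

theorem finprod_geomHalf_ofBinary (x : BinaryTree Unit) :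
    ∏ᶠ u ∈ (ofBinary x).verts, geomHalf ((ofBinary x).numChildren u) =
      2⁻¹ ^ (2 * x.numNodes + 1) := by
  induction x with
  | nil =>
    change ∏ᶠ u ∈ ({[]} : Set (List ℕ+)), geomHalf (single.numChildren u) = _
    rw [finprod_mem_singleton, numChildren_single, geomHalf_apply]
    rfl
  | node _ l r hl hr =>
    rw [ofBinary, finprod_geomHalf_join (finite_verts_ofBinary l) (finite_verts_ofBinary r), hl,
      hr, BinaryTree.numNodes]
    ring

theorem tprod_geomHalf_ofBinary (x : BinaryTree Unit) :
    ∏' u : (ofBinary x).verts, geomHalf ((ofBinary x).numChildren u) =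
      2⁻¹ ^ (2 * x.numNodes + 1) := by
  have := (finite_verts_ofBinary x).to_subtype
  rw [← finprod_geomHalf_ofBinary, tprod_eq_finprod (Set.toFinite _)]
  exact finprod_set_coe_eq_finprod_mem (f := fun u => geomHalf ((ofBinary x).numChildren u)) _

end Weight

section Measurability

theorem continuous_deg (u : List ℕ+) : Continuous fun t : OrderedTree => t.deg u :=
  (continuous_apply u).comp (continuous_induced_dom (f := fun (t : OrderedTree) u => t.deg u))

theorem mem_verts_iff_deg_ne {t : OrderedTree} {u : List ℕ+} : u ∈ t.verts ↔ t.deg u ≠ -1 := by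
  by_cases h : u ∈ t.verts
  · simp only [deg, h, if_true, true_iff]
    omega
  · simp [deg, h]

theorem deg_injective : Function.Injective deg := fun s t h => by
  ext u
  rw [mem_verts_iff_deg_ne, mem_verts_iff_deg_ne, h]

instance : T2Space OrderedTree :=
  T2Space.of_injective_continuous deg_injective (continuous_pi continuous_deg)

theorem measurable_natSize : Measurable natSize := by
  have hsucc (n : ℕ) : MeasurableSet {t : OrderedTree | t.natSize = n + 1} := by
    rw [setOf_natSize_eq]
    exact Finset.measurableSet _
  have hzero : natSize ⁻¹' {0} = (⋃ n : ℕ, {t : OrderedTree | t.natSize = n + 1})ᶜ := by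
    ext t
    cases h : t.natSize <;> simp [h]
  refine measurable_to_countable' fun n => ?_
  cases n with
  | zero => exact hzero ▸ (MeasurableSet.iUnion hsucc).compl
  | succ n => exact hsucc n

end Measurability

end OrderedTree

/-- The weight `C_{s-1} 4^{-s}` of a part of size `s`, which is half the probability that a
Geometric(1/2)-Galton–Watson tree has `s` vertices. -/
noncomputable def partWeight : ℕ → ℝ≥0∞
  | 0 => 0
  | n + 1 => catalan n * 4⁻¹ ^ (n + 1)

theorem partWeight_zero : partWeight 0 = 0 := rfl

theorem partWeight_succ (n : ℕ) : partWeight (n + 1) = catalan n * 4⁻¹ ^ (n + 1) := rfl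

theorem inv_four_eq : (4 : ℝ≥0∞)⁻¹ = 2⁻¹ ^ 2 := by
  rw [← ENNReal.inv_pow]
  norm_num

theorem tsum_partWeight : ∑' s, partWeight s = 2⁻¹ := by
  have hhalf : (2 : ℝ≥0∞) * 4⁻¹ = 2⁻¹ := by
    rw [inv_four_eq, sq, ← mul_assoc, ENNReal.mul_inv_cancel (by simp) (by simp), one_mul]
  rw [tsum_eq_zero_add' ENNReal.summable]
  simp only [partWeight_zero, partWeight_succ, pow_succ, ← mul_assoc, zero_add]
  rw [ENNReal.tsum_mul_right, tsum_catalan_mul_pow, hhalf]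

namespace IsGaltonWatsonTree

open OrderedTree

variable {Ω : Type*} [MeasurableSpace Ω] {μ : Measure Ω} {T : Ω → OrderedTree}

theorem measure_natSize_eq_succ (hT : IsGaltonWatsonTree geomHalf T μ) (n : ℕ) :
    μ {ω | (T ω).natSize = n + 1} = 2 * partWeight (n + 1) := by
  have hpre : {ω | (T ω).natSize = n + 1} = T ⁻¹' {t | t.natSize = n + 1} := rfl
  have hweight : ∀ x ∈ BinaryTree.treesOfNumNodesEq n,
      μ (T ⁻¹' {ofBinary x}) = 2⁻¹ ^ (2 * n + 1) := fun x hx => by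
    rw [hT.2, tprod_geomHalf_ofBinary, BinaryTree.mem_treesOfNumNodesEq.1 hx]
  rw [hpre, setOf_natSize_eq,
    ← sum_measure_preimage_singleton _ (fun t _ => hT.1 (measurableSet_singleton t)),
    Finset.sum_map]
  refine (Finset.sum_congr rfl hweight).trans ?_
  have htwo : (2 : ℝ≥0∞) * 2⁻¹ = 1 := ENNReal.mul_inv_cancel (by simp) (by simp)
  rw [Finset.sum_const, BinaryTree.treesOfNumNodesEq_card_eq_catalan, nsmul_eq_mul,
    partWeight_succ, inv_four_eq, ← pow_mul, mul_left_comm]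
  congr 1
  rw [Nat.mul_succ, pow_succ' _ (2 * n + 1), ← mul_assoc, htwo, one_mul]

theorem measure_natSize_eq [IsProbabilityMeasure μ] (hT : IsGaltonWatsonTree geomHalf T μ)
    (s : ℕ) : μ {ω | (T ω).natSize = s} = 2 * partWeight s := by
  rcases s with _ | s
  · have hm : Measurable fun ω => (T ω).natSize := measurable_natSize.comp hT.1
    have htotal : ∑' s, μ {ω | (T ω).natSize = s} = 1 := by
      rw [← tsum_univ]
      exact (tsum_measure_preimage_singleton (f := fun ω => (T ω).natSize) Set.countable_univ
        fun s _ => hm (measurableSet_singleton s)).trans (by simp)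
    have hpos : ∑' n, μ {ω | (T ω).natSize = n + 1} = 1 := by
      have := tsum_eq_zero_add' (f := partWeight) ENNReal.summable
      rw [tsum_partWeight, partWeight_zero, zero_add] at this
      simp only [hT.measure_natSize_eq_succ]
      rw [ENNReal.tsum_mul_left, ← this, ENNReal.mul_inv_cancel (by simp) (by simp)]
    rw [tsum_eq_zero_add' ENNReal.summable, hpos] at htotal
    rw [ENNReal.eq_sub_of_add_eq ENNReal.one_ne_top htotal, tsub_self, partWeight_zero, mul_zero]
  · exact hT.measure_natSize_eq_succ s

theorem ae_natSize_ne_zero [IsProbabilityMeasure μ] (hT : IsGaltonWatsonTree geomHalf T μ) :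
    ∀ᵐ ω ∂μ, (T ω).natSize ≠ 0 := by
  simpa [ae_iff, partWeight_zero] using hT.measure_natSize_eq 0

end IsGaltonWatsonTree

/-! ### Hills of sequences of parts -/

section ListSums

variable {α : Type*}

theorem tsum_fin_prod_eq_pow (w : α → ℝ≥0∞) (k : ℕ) :
    ∑' v : Fin k → α, ∏ i, w (v i) = (∑' a, w a) ^ k := by
  induction k with
  | zero => simp
  | succ k ih =>
    rw [← (Fin.consEquiv fun _ => α).tsum_eq, ENNReal.tsum_prod']
    simp only [Fin.consEquiv_apply, Fin.prod_univ_succ, Fin.cons_zero, Fin.cons_succ,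
      ENNReal.tsum_mul_left, ih, ENNReal.tsum_mul_right, pow_succ']

theorem tsum_list_prod_map (w : α → ℝ≥0∞) :
    ∑' u : List α, (u.map w).prod = (1 - ∑' a, w a)⁻¹ := by
  rw [← List.equivSigmaTuple.symm.tsum_eq, ENNReal.tsum_sigma', ← ENNReal.tsum_geometric]
  refine tsum_congr fun k => ?_
  rw [← tsum_fin_prod_eq_pow]
  refine tsum_congr fun v => ?_
  simp [List.equivSigmaTuple, List.map_ofFn, List.prod_ofFn]

theorem tsum_list_eq_add_tsum_cons (f : List α → ℝ≥0∞) :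
    ∑' u, f u = f [] + ∑' s, ∑' u, f (s :: u) := by
  let e : Unit ⊕ (α × List α) ≃ List α :=
    { toFun := Sum.elim (fun _ => []) fun p => p.1 :: p.2
      invFun
        | [] => Sum.inl ()
        | s :: u => Sum.inr (s, u)
      left_inv := by rintro (_ | ⟨s, u⟩) <;> rfl
      right_inv := by rintro (_ | ⟨s, u⟩) <;> rfl }
  rw [← e.tsum_eq, ENNReal.summable.tsum_sum ENNReal.summable, ← ENNReal.tsum_prod]
  congr 1
  simp [e]

end ListSums

section HillSet

/-- The set of hills of a sequence of parts: the starting positions of the parts of size one when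
the parts are laid out consecutively. -/
def hillSet : List ℕ → Finset ℕ
  | [] => ∅
  | s :: u => (if s = 1 then {0} else ∅) ∪ (hillSet u).map (addLeftEmbedding s)

theorem hillSet_cons_eq_empty_iff (s : ℕ) (u : List ℕ) :
    hillSet (s :: u) = ∅ ↔ s ≠ 1 ∧ hillSet u = ∅ := by
  by_cases h : s = 1 <;> simp [hillSet, h]

theorem hillSet_one_cons_eq_iff (u : List ℕ) (g : ℕ) (G : List ℕ) :
    hillSet (1 :: u) = gapSet (g :: G) ↔ g = 0 ∧ hillSet u = gapSet G := by
  refine ⟨fun h => ?_, ?_⟩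
  · have hzero : 0 ∈ gapSet (g :: G) := h ▸ by simp [hillSet]
    obtain rfl : g = 0 := by simpa [gapSet, eq_comm] using hzero
    simp only [hillSet, gapSet, if_true, zero_add, Finset.insert_eq] at h
    exact ⟨rfl, ((union_map_addLeft_inj (by simp) (by simp)).1 h).2⟩
  · rintro ⟨rfl, h⟩
    simp [hillSet, gapSet, h]

theorem gapSet_add_cons (s g : ℕ) (G : List ℕ) :
    gapSet ((s + g) :: G) = (gapSet (g :: G)).map (addLeftEmbedding s) := by
  ext x
  simp [gapSet, add_assoc]

theorem hillSet_cons_eq_gapSet_iff {s : ℕ} (hs : s ≠ 1) (u : List ℕ) (g : ℕ) (G : List ℕ) :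
    hillSet (s :: u) = gapSet (g :: G) ↔ s ≤ g ∧ hillSet u = gapSet ((g - s) :: G) := by
  have hshift : hillSet (s :: u) = (hillSet u).map (addLeftEmbedding s) := by simp [hillSet, hs]
  have hmem : g ∈ gapSet (g :: G) := by simp [gapSet]
  rw [hshift]
  constructor
  · intro h
    obtain ⟨y, _, hy⟩ := Finset.mem_map.1 (h ▸ hmem)
    obtain rfl : s + y = g := hy
    refine ⟨Nat.le_add_right s y, Finset.map_injective (addLeftEmbedding s) ?_⟩
    rw [h, Nat.add_sub_cancel_left, gapSet_add_cons]
  · rintro ⟨hle, h⟩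
    rw [h, ← gapSet_add_cons, Nat.add_sub_cancel' hle]

end HillSet

section HillWeight

/-- The weight of a finite sequence of parts. -/
noncomputable def listWeight (u : List ℕ) : ℝ≥0∞ := (u.map partWeight).prod

/-- The total weight of the sequences of parts with a given set of hills. -/
noncomputable def hillWeight (A : Finset ℕ) : ℝ≥0∞ :=
  ∑' u : List ℕ, if hillSet u = A then listWeight u else 0

theorem hillWeight_eq (A : Finset ℕ) : hillWeight A = (if A = ∅ then 1 else 0) +
    ∑' s, partWeight s * ∑' u, if hillSet (s :: u) = A then listWeight u else 0 := by
  rw [hillWeight, tsum_list_eq_add_tsum_cons]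
  congr 1
  · simp [hillSet, listWeight, eq_comm]
  · simp only [← ENNReal.tsum_mul_left, mul_ite, mul_zero, listWeight, List.map_cons,
      List.prod_cons]

theorem tsum_partWeight_ne_one : ∑' s, (if s = 1 then 0 else partWeight s) = 4⁻¹ := by
  have hone : partWeight 1 = 4⁻¹ := by simp [partWeight_succ 0]
  have hhalf : (2 : ℝ≥0∞)⁻¹ = 4⁻¹ + 4⁻¹ := by
    rw [inv_four_eq, sq, ← mul_add, ENNReal.inv_two_add_inv_two, mul_one]
  have htotal := tsum_partWeight
  rw [ENNReal.tsum_eq_add_tsum_ite 1, hone, hhalf] at htotal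
  convert (ENNReal.add_right_inj (a := 4⁻¹) (by simp)).1 htotal

theorem hillWeight_empty : hillWeight ∅ = 4 / 3 := by
  have hweight (u : List ℕ) : (if hillSet u = ∅ then listWeight u else 0) =
      (u.map fun s => if s = 1 then 0 else partWeight s).prod := by
    induction u with
    | nil => simp [hillSet, listWeight]
    | cons s u ih =>
      rw [List.map_cons, List.prod_cons, ← ih]
      by_cases hs : s = 1 <;> simp [hillSet_cons_eq_empty_iff, listWeight, hs]
  have hcompl : (1 : ℝ≥0∞) - 4⁻¹ = 3 / 4 := by
    refine ENNReal.sub_eq_of_eq_add (by simp) ?_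
    rw [← one_div, ENNReal.div_add_div_same]
    norm_num [ENNReal.div_self]
  rw [hillWeight, tsum_congr hweight, tsum_list_prod_map, tsum_partWeight_ne_one, hcompl,
    ENNReal.inv_div (by simp) (by simp)]

theorem hillWeight_gapSet_cons_eq_sum (g : ℕ) (G : List ℕ) :
    hillWeight (gapSet (g :: G)) = (if g = 0 then 4⁻¹ * hillWeight (gapSet G) else 0) +
      ∑ i ∈ Finset.range (g - 1),
        partWeight (i + 2) * hillWeight (gapSet ((g - (i + 2)) :: G)) := by
  have hne : gapSet (g :: G) ≠ ∅ := by simp [gapSet]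
  have hone : (∑' u, if hillSet (1 :: u) = gapSet (g :: G) then listWeight u else 0) =
      if g = 0 then hillWeight (gapSet G) else 0 := by
    by_cases h : g = 0 <;> simp [hillSet_one_cons_eq_iff, h, hillWeight]
  have htwo (i : ℕ) :
      (∑' u, if hillSet ((i + 2) :: u) = gapSet (g :: G) then listWeight u else 0) =
        if i + 2 ≤ g then hillWeight (gapSet ((g - (i + 2)) :: G)) else 0 := by
    by_cases h : i + 2 ≤ g <;>
      simp [hillSet_cons_eq_gapSet_iff (show i + 2 ≠ 1 by omega), h, hillWeight]
  rw [hillWeight_eq, if_neg hne, zero_add, tsum_eq_zero_add' ENNReal.summable,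
    tsum_eq_zero_add' ENNReal.summable]
  simp only [partWeight_zero, zero_mul, zero_add, hone, htwo, add_assoc, Nat.reduceAdd]
  congr 1
  · simp [partWeight_succ 0]
  · rw [tsum_eq_sum (s := Finset.range (g - 1))]
    · refine Finset.sum_congr rfl fun i hi => ?_
      have := Finset.mem_range.1 hi
      rw [if_pos (by omega)]
    · intro i hi
      have := mt Finset.mem_range.2 hi
      rw [if_neg (by omega), mul_zero]

theorem hillWeight_gapSet_cons (g : ℕ) (G : List ℕ) :
    hillWeight (gapSet (g :: G)) = fineNumber g * 4⁻¹ ^ (g + 1) * hillWeight (gapSet G) := by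
  induction g using Nat.strong_induction_on with
  | _ g ih =>
    rw [hillWeight_gapSet_cons_eq_sum]
    rcases g with _ | g
    · simp [fineNumber_zero]
    · rw [if_neg g.succ_ne_zero, zero_add, Nat.add_sub_cancel, fineNumber_succ, Nat.cast_sum,
        Finset.sum_mul, Finset.sum_mul]
      refine Finset.sum_congr rfl fun i hi => ?_
      have hi := Finset.mem_range.1 hi
      rw [ih _ (by omega), partWeight_succ, show g + 1 - (i + 2) = g - 1 - i by omega,
        show g + 1 + 1 = (i + 1 + 1) + (g - 1 - i + 1) by omega, pow_add]
      push_cast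
      ring

theorem hillWeight_gapSet (G : List ℕ) :
    hillWeight (gapSet G) = 4 / 3 * (4⁻¹ ^ gapSpan G * (G.map fineNumber).prod) := by
  induction G with
  | nil => simp [gapSet, gapSpan, hillWeight_empty]
  | cons g G ih =>
    rw [hillWeight_gapSet_cons, ih, gapSpan, List.map_cons, List.prod_cons, pow_add]
    push_cast
    ring

end HillWeight

/-! ### The trees along the spine -/

section SpineIndex

variable {M : Type*} [AddCommMonoid M]

/-- The positive integer `X - i`; it is the junk value `1` for `i ≥ X`. -/
def countFromRight (X : ℕ+) (i : ℕ) : ℕ+ := Nat.toPNat' (X - i)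

theorem coe_countFromRight {X : ℕ+} {i : ℕ} (h : i < X) : (countFromRight X i : ℕ) = X - i := by
  rw [countFromRight, Nat.toPNat'_coe, if_pos (by omega)]

theorem countFromRight_sub {X j : ℕ+} (h : j ≤ X) : countFromRight X (X - j) = j := by
  have hle : (j : ℕ) ≤ X := h
  have hpos := j.pos
  refine PNat.eq ?_
  rw [coe_countFromRight (by omega)]
  omega

theorem sum_Ico_one_eq_sum_range (f : ℕ+ → M) (N : ℕ+) :
    ∑ i ∈ Finset.Ico 1 N, f i = ∑ i ∈ Finset.range (N - 1), f (Nat.succPNat i) := by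
  refine Finset.sum_nbij' PNat.natPred Nat.succPNat ?_ ?_ (fun i _ => PNat.succPNat_natPred i)
    (fun i _ => Nat.natPred_succPNat i) fun i _ => by rw [PNat.succPNat_natPred]
  · intro i hi
    have hlt : (i : ℕ) < N := (Finset.mem_Ico.1 hi).2
    have hpos := i.pos
    rw [Finset.mem_range, PNat.natPred]
    omega
  · intro i hi
    have hlt := Finset.mem_range.1 hi
    rw [Finset.mem_Ico, ← PNat.coe_lt_coe, Nat.succPNat_coe]
    exact ⟨one_le, by omega⟩

theorem sum_Icc_eq_sum_range (f : ℕ+ → M) (a b : ℕ+) :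
    ∑ i ∈ Finset.Icc a b, f i = ∑ i ∈ Finset.range (b + 1 - a), f (countFromRight b i) := by
  have ha := a.pos
  have hle {i : ℕ+} (hi : i ∈ Finset.Icc a b) : i ≤ b := (Finset.mem_Icc.1 hi).2
  refine Finset.sum_nbij' (fun i => (b : ℕ) - i) (countFromRight b) ?_ ?_
    (fun i hi => countFromRight_sub (hle hi)) ?_
    fun i hi => congrArg f (countFromRight_sub (hle hi)).symm
  · intro i hi
    rw [Finset.mem_Icc, ← PNat.coe_le_coe, ← PNat.coe_le_coe] at hi
    rw [Finset.mem_range]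
    omega
  · intro i hi
    have hlt := Finset.mem_range.1 hi
    rw [Finset.mem_Icc, ← PNat.coe_le_coe, ← PNat.coe_le_coe, coe_countFromRight (by omega)]
    omega
  · intro i hi
    have hlt := Finset.mem_range.1 hi
    rw [coe_countFromRight (by omega)]
    omega

theorem injective_succPNat_countFromRight {a b : ℕ} {k : ℕ+} (h : a + b ≤ k) :
    Function.Injective (Sum.elim (fun i : Fin a => Nat.succPNat i)
      fun i : Fin b => countFromRight k i) := by
  have hcoe (i : Fin b) : (countFromRight k i : ℕ) = k - i := coe_countFromRight (by omega)
  refine Function.Injective.sumElim (fun i j hij => ?_) (fun i j hij => ?_) fun i j hij => ?_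
  · exact Fin.ext (Nat.succPNat_injective hij)
  · have hval := congrArg PNat.val hij
    change (countFromRight k i : ℕ) = countFromRight k j at hval
    rw [hcoe, hcoe] at hval
    omega
  · have hval := congrArg PNat.val hij
    change (i : ℕ) + 1 = countFromRight k j at hval
    rw [hcoe] at hval
    omega

end SpineIndex

section SpineLists

/-- The sizes of the trees to the left of the spine, from left to right. -/
noncomputable def leftList (t : ℕ+ → OrderedTree) (N : ℕ+) : List ℕ :=
  List.ofFn fun i : Fin (N - 1 : ℕ) => (t (Nat.succPNat i)).natSize

/-- The sizes of the trees to the right of the spine, from right to left. -/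
noncomputable def rightList (t : ℕ+ → OrderedTree) (X N : ℕ+) : List ℕ :=
  List.ofFn fun i : Fin (X - N : ℕ) => (t (countFromRight X i)).natSize

theorem ofFn_eq_iff {α : Type*} {k : ℕ} (f : ℕ → α) (u : List α) :
    (List.ofFn fun i : Fin k => f i) = u ↔ k = u.length ∧ ∀ i : Fin u.length, f i = u[i] := by
  simp +contextual [List.ext_getElem_iff, Fin.forall_iff]

theorem leftList_eq_iff (t : ℕ+ → OrderedTree) (N : ℕ+) (u : List ℕ) :
    leftList t N = u ↔ (N : ℕ) - 1 = u.length ∧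
      ∀ i : Fin u.length, (t (Nat.succPNat i)).natSize = u[i] :=
  ofFn_eq_iff (fun i => (t (Nat.succPNat i)).natSize) u

theorem rightList_eq_iff (t : ℕ+ → OrderedTree) (X N : ℕ+) (u : List ℕ) :
    rightList t X N = u ↔ (X : ℕ) - N = u.length ∧
      ∀ i : Fin u.length, (t (countFromRight X i)).natSize = u[i] :=
  ofFn_eq_iff (fun i => (t (countFromRight X i)).natSize) u

theorem leftList_eq_and_rightList_eq_iff (t : ℕ+ → OrderedTree) {X N : ℕ+} (h : N ≤ X)
    (u v : List ℕ) :
    leftList t N = u ∧ rightList t X N = v ↔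
      (X = Nat.succPNat (u.length + v.length) ∧ N = Nat.succPNat u.length) ∧
        ∀ i : Fin u.length ⊕ Fin v.length,
          (t (Sum.elim (fun i : Fin u.length => Nat.succPNat i)
            (fun i : Fin v.length => countFromRight (Nat.succPNat (u.length + v.length)) i)
              i)).natSize = Sum.elim u.get v.get i := by
  have hle : (N : ℕ) ≤ X := h
  have hpos := N.pos
  have hlength : (N : ℕ) - 1 = u.length ∧ (X : ℕ) - N = v.length ↔
      X = Nat.succPNat (u.length + v.length) ∧ N = Nat.succPNat u.length := by
    simp only [← PNat.coe_inj, Nat.succPNat_coe]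
    omega
  rw [leftList_eq_iff, rightList_eq_iff, and_and_and_comm, hlength, Sum.forall]
  refine and_congr_right fun hXN => ?_
  rw [hXN.1]
  rfl

end SpineLists

section SpineLaw

variable {Ω : Type*} [MeasurableSpace Ω] {μ : Measure Ω} [IsProbabilityMeasure μ]
  {T : ℕ+ → Ω → OrderedTree} {X N : Ω → ℕ+}

theorem measure_sizeBiased_pair (hX_meas : Measurable X)
    (hX : ∀ k : ℕ+, μ (X ⁻¹' {k}) = sizeBiased geomHalf k)
    (hN : ∀ k m : ℕ+, m ≤ k → (cond μ (X ⁻¹' {k})) (N ⁻¹' {m}) = (k : ℝ≥0∞)⁻¹)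
    {k m : ℕ+} (hmk : m ≤ k) :
    μ ((fun ω => (X ω, N ω)) ⁻¹' {(k, m)}) = 2⁻¹ ^ ((k : ℕ) + 1) := by
  rw [← Set.singleton_prod_singleton, Set.mk_preimage_prod,
    ← cond_mul_eq_inter (hX_meas (measurableSet_singleton k)), hN k m hmk, hX k, sizeBiased,
    ← mul_assoc, ENNReal.inv_mul_cancel (by simp) (by simp), one_mul]
  rfl

theorem ae_le_of_cond_uniform (hX_meas : Measurable X) (hN_meas : Measurable N)
    (hN : ∀ k m : ℕ+, m ≤ k → (cond μ (X ⁻¹' {k})) (N ⁻¹' {m}) = (k : ℝ≥0∞)⁻¹) :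
    ∀ᵐ ω ∂μ, N ω ≤ X ω := by
  suffices h : ∀ k : ℕ+, ∀ᵐ ω ∂μ, X ω = k → N ω ≤ k by
    filter_upwards [ae_all_iff.2 h] with ω hω using hω _ rfl
  intro k
  have hX_k := hX_meas (measurableSet_singleton k)
  have hIcc := hN_meas (Finset.measurableSet (Finset.Icc 1 k))
  suffices h : μ (X ⁻¹' {k} ∩ (N ⁻¹' (Finset.Icc 1 k : Finset ℕ+))ᶜ) = 0 by
    rw [ae_iff]
    refine measure_mono_null (fun ω hω => ?_) h
    simpa using hω
  by_cases h0 : μ (X ⁻¹' {k}) = 0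
  · exact measure_mono_null Set.inter_subset_left h0
  · have := cond_isProbabilityMeasure h0
    have hone : cond μ (X ⁻¹' {k}) (N ⁻¹' (Finset.Icc 1 k : Finset ℕ+)) = 1 := by
      rw [← sum_measure_preimage_singleton _ fun y _ => hN_meas (measurableSet_singleton y),
        Finset.sum_congr rfl fun m hm => hN k m (Finset.mem_Icc.1 hm).2, Finset.sum_const,
        PNat.card_Icc, nsmul_eq_mul]
      simpa using ENNReal.mul_inv_cancel (a := k) (by simp) (by simp)
    rw [← cond_mul_eq_inter hX_k, (prob_compl_eq_zero_iff hIcc).2 hone, zero_mul]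

theorem measure_forall_natSize_eq {ι : Type*} [Fintype ι]
    (hT : ∀ j, IsGaltonWatsonTree geomHalf (T j) μ) (hT_indep : iIndepFun T μ)
    {g : ι → ℕ+} (hg : Function.Injective g) (c : ι → ℕ) :
    μ {ω | ∀ i, (T (g i) ω).natSize = c i} = ∏ i, 2 * partWeight (c i) := by
  have hinter : {ω | ∀ i, (T (g i) ω).natSize = c i} =
      ⋂ i ∈ Finset.univ, T (g i) ⁻¹' {t | t.natSize = c i} := by
    ext ω
    simp
  rw [hinter, (hT_indep.precomp hg).measure_inter_preimage_eq_mul Finset.univ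
    (sets := fun i => {t | t.natSize = c i})
    fun i _ => OrderedTree.measurable_natSize (measurableSet_singleton (c i))]
  exact Finset.prod_congr rfl fun i _ => (hT (g i)).measure_natSize_eq (c i)

theorem prod_two_mul_partWeight_get (u : List ℕ) :
    ∏ i, 2 * partWeight (u.get i) = 2 ^ u.length * listWeight u := by
  rw [Finset.prod_mul_distrib, Finset.prod_const, Finset.card_univ, Fintype.card_fin]
  exact congrArg _ (Fin.prod_univ_fun_getElem u partWeight)

theorem measure_leftList_rightList
    (hT : ∀ j, IsGaltonWatsonTree geomHalf (T j) μ) (hT_indep : iIndepFun T μ)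
    (hX_meas : Measurable X) (hN_meas : Measurable N)
    (hX : ∀ k : ℕ+, μ (X ⁻¹' {k}) = sizeBiased geomHalf k)
    (hN : ∀ k m : ℕ+, m ≤ k → (cond μ (X ⁻¹' {k})) (N ⁻¹' {m}) = (k : ℝ≥0∞)⁻¹)
    (hXN_indep : IndepFun (fun ω => (X ω, N ω)) (fun ω j => T j ω) μ) (u v : List ℕ) :
    μ {ω | leftList (fun j => T j ω) (N ω) = u ∧ rightList (fun j => T j ω) (X ω) (N ω) = v} =
      4⁻¹ * (listWeight u * listWeight v) := by
  set m := Nat.succPNat u.length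
  set k := Nat.succPNat (u.length + v.length) with hk
  set g : Fin u.length ⊕ Fin v.length → ℕ+ :=
    Sum.elim (fun i => Nat.succPNat i) fun i => countFromRight k i
  have hg_inj : Function.Injective g :=
    injective_succPNat_countFromRight (by rw [hk, Nat.succPNat_coe]; omega)
  let S : Set (ℕ+ → OrderedTree) := {t | ∀ i, (t (g i)).natSize = Sum.elim u.get v.get i}
  have hS : MeasurableSet S := by
    simp only [S, Set.ofPred_forall]
    exact MeasurableSet.iInter fun i =>
      (OrderedTree.measurable_natSize.comp (measurable_pi_apply (g i))) (measurableSet_singleton _)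
  have hevent : {ω | leftList (fun j => T j ω) (N ω) = u ∧
      rightList (fun j => T j ω) (X ω) (N ω) = v} =ᵐ[μ]
      ((fun ω => (X ω, N ω)) ⁻¹' {(k, m)} ∩ (fun ω j => T j ω) ⁻¹' S : Set Ω) := by
    refine eventuallyEq_set.2 ?_
    filter_upwards [ae_le_of_cond_uniform hX_meas hN_meas hN] with ω hω
    simp only [Set.mem_inter_iff, Set.mem_preimage, Set.mem_singleton_iff, Prod.mk.injEq]
    exact leftList_eq_and_rightList_eq_iff (fun j => T j ω) hω u v
  have hmk : m ≤ k := Nat.succPNat_mono (Nat.le_add_right _ _)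
  have hpow : (2⁻¹ : ℝ≥0∞) ^ (u.length + v.length + 2) * (2 ^ u.length * 2 ^ v.length) = 4⁻¹ := by
    rw [← pow_add, inv_four_eq, pow_add, mul_right_comm, ← mul_pow,
      ENNReal.inv_mul_cancel two_ne_zero ENNReal.ofNat_ne_top, one_pow, one_mul]
  calc _ = μ ((fun ω => (X ω, N ω)) ⁻¹' {(k, m)}) *
          μ {ω | ∀ i, (T (g i) ω).natSize = Sum.elim u.get v.get i} := by
        rw [measure_congr hevent,
          hXN_indep.measure_inter_preimage_eq_mul _ _ (measurableSet_singleton _) hS]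
        rfl
    _ = 2⁻¹ ^ (u.length + v.length + 2) *
          ((2 ^ u.length * listWeight u) * (2 ^ v.length * listWeight v)) := by
        rw [measure_sizeBiased_pair hX_meas hX hN hmk, measure_forall_natSize_eq hT hT_indep hg_inj,
          Fintype.prod_sum_type, ← prod_two_mul_partWeight_get, ← prod_two_mul_partWeight_get]
        rfl
    _ = 4⁻¹ * (listWeight u * listWeight v) := by
        rw [← hpow]
        ring

end SpineLaw

/-! ### Convergence of the positions -/

section PointMeasure

theorem sum_hillSet_ofFn {M : Type*} [AddCommMonoid M] (F : ℕ → M) (f : ℕ → ℕ) (k : ℕ)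
    (hf : ∀ i < k, f i ≠ 0) :
    ∑ a ∈ hillSet (List.ofFn fun i : Fin k => f i), F a =
      ∑ i ∈ Finset.range k, if f i = 1 then F (∑ j ∈ Finset.range i, f j) else 0 := by
  induction k generalizing F f with
  | zero => simp [hillSet]
  | succ k ih =>
    have h0 := hf 0 k.succ_pos
    have hdisj : Disjoint (if f 0 = 1 then ({0} : Finset ℕ) else ∅)
        ((hillSet (List.ofFn fun i : Fin k => f (i + 1))).map (addLeftEmbedding (f 0))) := by
      split_ifs <;> simp [h0]
    have hcons : hillSet (List.ofFn fun i : Fin (k + 1) => f i) = (if f 0 = 1 then {0} else ∅) ∪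
        (hillSet (List.ofFn fun i : Fin k => f (i + 1))).map (addLeftEmbedding (f 0)) := by
      rw [List.ofFn_succ]
      rfl
    rw [hcons, Finset.sum_union hdisj, Finset.sum_map, Finset.sum_range_succ', add_comm]
    congr 1
    · simp only [addLeftEmbedding_apply]
      rw [ih (fun a => F (f 0 + a)) (fun i => f (i + 1)) fun i hi => hf (i + 1) (by omega)]
      simp only [Finset.sum_range_succ' f, add_comm]
    · by_cases h1 : f 0 = 1 <;> simp [h1]

/-- The finite measure with unit masses at the successors of the elements of `A`. -/
noncomputable def pointMeasure (A : Finset ℕ) : FiniteMeasure ℕ+ :=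
  ∑ a ∈ A, diracFM (Nat.succPNat a)

theorem OrderedTree.coe_natSize {t : OrderedTree} (h : t.natSize ≠ 0) : (t.natSize : ℕ∞) = t.size :=
  ((t.natSize_eq_iff h).1 rfl).symm

theorem OrderedTree.natSize_eq_one_iff (t : OrderedTree) : t.natSize = 1 ↔ t.size = 1 :=
  mod_cast t.natSize_eq_iff one_ne_zero

variable {t : ℕ+ → OrderedTree}

theorem cumulativeSize_eq (ht : ∀ j, (t j).natSize ≠ 0) (a b : ℕ+) :
    cumulativeSize t a b = (∑ j ∈ Finset.Icc a b, (t j).natSize).toPNat' := by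
  rw [cumulativeSize, ← Finset.sum_congr rfl fun j _ => OrderedTree.coe_natSize (ht j),
    ← Nat.cast_sum, ENat.toNat_natCast]

theorem cumulativeSize_one_succPNat (ht : ∀ j, (t j).natSize ≠ 0) {i : ℕ}
    (hi : (t (Nat.succPNat i)).natSize = 1) : cumulativeSize t 1 (Nat.succPNat i) =
      Nat.succPNat (∑ j ∈ Finset.range i, (t (Nat.succPNat j)).natSize) := by
  rw [cumulativeSize_eq ht, ← Finset.Ico_add_one_right_eq_Icc, sum_Ico_one_eq_sum_range,
    PNat.add_coe, PNat.one_coe, Nat.add_sub_cancel, Nat.succPNat_coe, Finset.sum_range_succ, hi]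
  rfl

theorem cumulativeSize_countFromRight (ht : ∀ j, (t j).natSize ≠ 0) {X : ℕ+} {i : ℕ} (hiX : i < X)
    (hi : (t (countFromRight X i)).natSize = 1) : cumulativeSize t (countFromRight X i) X =
      Nat.succPNat (∑ j ∈ Finset.range i, (t (countFromRight X j)).natSize) := by
  rw [cumulativeSize_eq ht, sum_Icc_eq_sum_range, coe_countFromRight hiX,
    show (X : ℕ) + 1 - (X - i) = i + 1 by omega, Finset.sum_range_succ, hi]
  rfl

theorem spineLeft_eq (ht : ∀ j, (t j).natSize ≠ 0) (N : ℕ+) :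
    spineLeft t N = pointMeasure (hillSet (leftList t N)) := by
  rw [pointMeasure, leftList, sum_hillSet_ofFn _ (fun i => (t (Nat.succPNat i)).natSize) _
    fun _ _ => ht _, spineLeft, sum_Ico_one_eq_sum_range]
  refine Finset.sum_congr rfl fun i _ => ?_
  by_cases hi : (t (Nat.succPNat i)).natSize = 1
  · rw [if_pos hi, if_pos ((t _).natSize_eq_one_iff.1 hi),
      cumulativeSize_one_succPNat ht hi]
  · rw [if_neg hi, if_neg (mt (t _).natSize_eq_one_iff.2 hi)]

theorem spineRight_eq (ht : ∀ j, (t j).natSize ≠ 0) (X N : ℕ+) :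
    spineRight t X N = pointMeasure (hillSet (rightList t X N)) := by
  rw [pointMeasure, rightList, sum_hillSet_ofFn _ (fun i => (t (countFromRight X i)).natSize) _
    fun _ _ => ht _, spineRight, ← Finset.Icc_add_one_left_eq_Ioc, sum_Icc_eq_sum_range,
    PNat.add_coe, PNat.one_coe, Nat.add_sub_add_right]
  refine Finset.sum_congr rfl fun i hiX => ?_
  have hiX := Finset.mem_range.1 hiX
  by_cases hi : (t (countFromRight X i)).natSize = 1
  · rw [if_pos hi, if_pos ((t _).natSize_eq_one_iff.1 hi),
      cumulativeSize_countFromRight ht (by omega) hi]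
  · rw [if_neg hi, if_neg (mt (t _).natSize_eq_one_iff.2 hi)]

end PointMeasure

section PositionPair

/-- Pairs of finite sets of positions, as a discrete space. -/
@[ext]
structure PositionPair where
  left : Finset ℕ
  right : Finset ℕ

instance : TopologicalSpace PositionPair := ⊥

instance : DiscreteTopology PositionPair := ⟨rfl⟩

instance : MeasurableSpace PositionPair := ⊤

instance : BorelSpace PositionPair := ⟨(borel_eq_top_of_discrete (α := PositionPair)).symm⟩

instance : Countable PositionPair :=
  Function.Injective.countable (f := fun p : PositionPair => (p.left, p.right)) fun _ _ h =>
    PositionPair.ext (congrArg Prod.fst h) (congrArg Prod.snd h)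

/-- The pair of point measures with given positions. -/
noncomputable def pointMeasurePair (p : PositionPair) : FiniteMeasurePair :=
  (pointMeasure p.left, pointMeasure p.right)

end PositionPair

section SpinePositions

/-- The positions of the single-vertex trees on both sides of the spine. -/
noncomputable def spinePositions (t : ℕ+ → OrderedTree) (X N : ℕ+) : PositionPair :=
  ⟨hillSet (leftList t N), hillSet (rightList t X N)⟩

theorem pointMeasurePair_spinePositions {t : ℕ+ → OrderedTree} (ht : ∀ j, (t j).natSize ≠ 0)
    (X N : ℕ+) : pointMeasurePair (spinePositions t X N) = spinePair t X N :=
  (Prod.ext (spineLeft_eq ht N) (spineRight_eq ht X N)).symm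

variable {Ω : Type*} {T : ℕ+ → Ω → OrderedTree} {X N : Ω → ℕ+}

theorem preimage_spinePositions_eq_biUnion (p : PositionPair) :
    (fun ω => spinePositions (fun j => T j ω) (X ω) (N ω)) ⁻¹' {p} =
      ⋃ w ∈ {w : List ℕ × List ℕ | hillSet w.1 = p.left ∧ hillSet w.2 = p.right},
        {ω | leftList (fun j => T j ω) (N ω) = w.1 ∧
          rightList (fun j => T j ω) (X ω) (N ω) = w.2} := by
  ext ω
  simp [spinePositions, PositionPair.ext_iff]

variable [MeasurableSpace Ω]

theorem measurableSet_leftList_rightList (hT : ∀ j, Measurable (T j))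
    (hX_meas : Measurable X) (hN_meas : Measurable N) (u v : List ℕ) :
    MeasurableSet {ω | leftList (fun j => T j ω) (N ω) = u ∧
      rightList (fun j => T j ω) (X ω) (N ω) = v} := by
  have hjoint : Measurable fun p : ℕ+ × Ω => (T p.1 p.2).natSize :=
    measurable_from_prod_countable_right fun j => OrderedTree.measurable_natSize.comp (hT j)
  have hsize (h : ℕ+ → ℕ+) (c : ℕ) : MeasurableSet {ω | (T (h (X ω)) ω).natSize = c} :=
    (hjoint.comp (((measurable_of_countable h).comp hX_meas).prodMk measurable_id))
      (measurableSet_singleton c)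
  have hXN (s : Set (ℕ+ × ℕ+)) : MeasurableSet {ω | (X ω, N ω) ∈ s} :=
    (hX_meas.prodMk hN_meas) s.to_countable.measurableSet
  simp only [leftList_eq_iff, rightList_eq_iff]
  have hleft : MeasurableSet {ω | ∀ i : Fin u.length, (T (Nat.succPNat i) ω).natSize = u[i]} := by
    rw [Set.ofPred_forall]
    exact MeasurableSet.iInter fun i => hsize (fun _ => Nat.succPNat i) _
  have hright : MeasurableSet
      {ω | ∀ i : Fin v.length, (T (countFromRight (X ω) i) ω).natSize = v[i]} := by
    rw [Set.ofPred_forall]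
    exact MeasurableSet.iInter fun i => hsize (fun x => countFromRight x i) _
  exact ((hXN {p | (p.2 : ℕ) - 1 = u.length}).inter hleft).inter
    ((hXN {p | (p.1 : ℕ) - p.2 = v.length}).inter hright)

theorem measurable_spinePositions (hT : ∀ j, Measurable (T j))
    (hX_meas : Measurable X) (hN_meas : Measurable N) :
    Measurable fun ω => spinePositions (fun j => T j ω) (X ω) (N ω) := by
  refine measurable_to_countable' fun p => ?_
  rw [preimage_spinePositions_eq_biUnion]
  exact MeasurableSet.biUnion (Set.to_countable _) fun w _ =>
    measurableSet_leftList_rightList hT hX_meas hN_meas w.1 w.2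

theorem tsum_listWeight_mul_listWeight (A B : Finset ℕ) :
    ∑' w : {w : List ℕ × List ℕ | hillSet w.1 = A ∧ hillSet w.2 = B},
      listWeight w.1.1 * listWeight w.1.2 = hillWeight A * hillWeight B := by
  classical
  rw [tsum_subtype {w : List ℕ × List ℕ | hillSet w.1 = A ∧ hillSet w.2 = B}
    fun w => listWeight w.1 * listWeight w.2, ENNReal.tsum_prod',
    hillWeight, ← ENNReal.tsum_mul_right]
  refine tsum_congr fun u => ?_
  rw [hillWeight, ← ENNReal.tsum_mul_left]
  refine tsum_congr fun v => ?_
  by_cases hu : hillSet u = A <;> by_cases hv : hillSet v = B <;> simp [Set.indicator, hu, hv]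

theorem measure_spinePositions {μ : Measure Ω} [IsProbabilityMeasure μ]
    (hT : ∀ j, IsGaltonWatsonTree geomHalf (T j) μ) (hT_indep : iIndepFun T μ)
    (hX_meas : Measurable X) (hN_meas : Measurable N)
    (hX : ∀ k : ℕ+, μ (X ⁻¹' {k}) = sizeBiased geomHalf k)
    (hN : ∀ k m : ℕ+, m ≤ k → (cond μ (X ⁻¹' {k})) (N ⁻¹' {m}) = (k : ℝ≥0∞)⁻¹)
    (hXN_indep : IndepFun (fun ω => (X ω, N ω)) (fun ω j => T j ω) μ) (p : PositionPair) :
    μ ((fun ω => spinePositions (fun j => T j ω) (X ω) (N ω)) ⁻¹' {p}) =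
      4⁻¹ * (hillWeight p.left * hillWeight p.right) := by
  rw [preimage_spinePositions_eq_biUnion, measure_biUnion (Set.to_countable _)]
  · simp only [measure_leftList_rightList hT hT_indep hX_meas hN_meas hX hN hXN_indep,
      ENNReal.tsum_mul_left]
    rw [tsum_listWeight_mul_listWeight]
  · intro w _ w' _ hne
    refine Set.disjoint_left.2 fun ω hω hω' => hne ?_
    exact Prod.ext (hω.1.symm.trans hω'.1) (hω.2.symm.trans hω'.2)
  · exact fun w _ => measurableSet_leftList_rightList (fun j => (hT j).1) hX_meas hN_meas w.1 w.2

end SpinePositions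

section FixedPositions

variable {n : ℕ}

/-- The fixed points in the first half. -/
def leftPositions (τ : Equiv.Perm (Fin n)) : Finset ℕ :=
  (fixedSet τ).filter fun a => a + 1 ≤ n / 2

/-- The fixed points in the second half, counted from the right end. -/
def rightPositions (τ : Equiv.Perm (Fin n)) : Finset ℕ :=
  revSet n ((fixedSet τ).filter fun a => n / 2 + 1 ≤ a + 1)

/-- The positions of the fixed points, counted from both ends. -/
def fixedPositions (τ : Equiv.Perm (Fin n)) : PositionPair :=
  ⟨leftPositions τ, rightPositions τ⟩

theorem fixedPointsLeft_eq (τ : Equiv.Perm (Fin n)) :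
    fixedPointsLeft τ = pointMeasure (leftPositions τ) := by
  rw [fixedPointsLeft, pointMeasure, leftPositions, Finset.sum_filter, fixedSet, Finset.sum_map,
    Finset.sum_filter]
  refine Finset.sum_congr rfl fun a _ => ?_
  by_cases hfix : τ a = a <;> simp [hfix]

theorem fixedPointsRight_eq (τ : Equiv.Perm (Fin n)) :
    fixedPointsRight τ = pointMeasure (rightPositions τ) := by
  rw [fixedPointsRight, pointMeasure, rightPositions, revSet, Finset.sum_image, Finset.sum_filter,
    fixedSet, Finset.sum_map, Finset.sum_filter]
  · refine Finset.sum_congr rfl fun a _ => ?_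
    by_cases hfix : τ a = a <;> simp [hfix, Nat.sub_sub, add_comm]
  · intro x hx y hy hxy
    have hxn := Finset.mem_range.1 (fixedSet_subset τ (Finset.mem_filter.1 hx).1)
    have hyn := Finset.mem_range.1 (fixedSet_subset τ (Finset.mem_filter.1 hy).1)
    simp only at hxy
    omega

theorem pointMeasurePair_fixedPositions (τ : Equiv.Perm (Fin n)) :
    pointMeasurePair (fixedPositions τ) = fixedPointPair τ :=
  (Prod.ext (fixedPointsLeft_eq τ) (fixedPointsRight_eq τ)).symm

theorem fixedPositions_eq_iff (τ : Equiv.Perm (Fin n)) {A B : Finset ℕ}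
    (hA : A ⊆ Finset.range (n / 2)) (hB : B ⊆ Finset.range (n - n / 2)) :
    fixedPositions τ = ⟨A, B⟩ ↔ fixedSet τ = A ∪ revSet n B := by
  have hBn : B ⊆ Finset.range n := hB.trans (Finset.range_mono (by omega))
  have hleft {x : ℕ} (hx : x ∈ A) : x + 1 ≤ n / 2 := Finset.mem_range.1 (hA hx)
  have hright {x : ℕ} (hx : x ∈ revSet n B) : n / 2 ≤ x := by
    obtain ⟨b, hb, rfl⟩ := Finset.mem_image.1 hx
    have := Finset.mem_range.1 (hB hb)
    omega
  rw [fixedPositions, PositionPair.mk.injEq, leftPositions, rightPositions]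
  constructor
  · rintro ⟨rfl, rfl⟩
    rw [revSet_revSet ((Finset.filter_subset _ _).trans (fixedSet_subset τ)), ← Finset.filter_or,
      Finset.filter_true_of_mem]
    intro x _
    omega
  · intro h
    have hfilter_left : ((A ∪ revSet n B).filter fun a => a + 1 ≤ n / 2) = A := by
      rw [Finset.filter_union, Finset.filter_true_of_mem fun x hx => hleft hx,
        Finset.filter_false_of_mem fun x hx => by have := hright hx; omega, Finset.union_empty]
    have hfilter_right : ((A ∪ revSet n B).filter fun a => n / 2 + 1 ≤ a + 1) = revSet n B := by
      rw [Finset.filter_union, Finset.filter_false_of_mem fun x hx => by have := hleft hx; omega,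
        Finset.filter_true_of_mem fun x hx => by have := hright hx; omega, Finset.empty_union]
    rw [h, hfilter_left, hfilter_right, revSet_revSet hBn]
    exact ⟨rfl, rfl⟩

instance instDiscreteMeasurableSpacePermFin : DiscreteMeasurableSpace (Equiv.Perm (Fin n)) :=
  ⟨fun _ => trivial⟩

theorem uniformOn_Av321_fixedSet (n : ℕ) (F : Finset ℕ) :
    uniformOn (Av321 n) {τ | fixedSet τ = F} = fixCount n F / catalan n := by
  classical
  rw [← ncard_Av321, fixCount, Set.ncard_eq_toFinset_card', Set.ncard_eq_toFinset_card' (Av321 n),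
    ← Set.coe_toFinset (Av321 n), ← Set.coe_toFinset {τ : Equiv.Perm (Fin n) | fixedSet τ = F},
    uniformOn_apply_finset]
  congr 3
  · ext τ
    simp
  · simp

theorem tendsto_fixCount_gapSet_div_catalan (G H : List ℕ) :
    Tendsto (fun n => (fixCount n (gapSet G ∪ revSet n (gapSet H)) : ℝ≥0∞) / catalan n) atTop
      (nhds (4⁻¹ * (hillWeight (gapSet G) * hillWeight (gapSet H)))) := by
  rw [← tendsto_add_atTop_iff_nat (gapSpan G + gapSpan H)]
  set p : ℕ := (G.map fineNumber).prod
  set q : ℕ := (H.map fineNumber).prod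
  have hlim := ENNReal.tendsto_ofReal
    ((tendsto_fineNumber_div_catalan_add (gapSpan G + gapSpan H)).const_mul ((p : ℝ) * q))
  have hvalue : ENNReal.ofReal ((p : ℝ) * q * (4 / 9 * 4⁻¹ ^ (gapSpan G + gapSpan H))) =
      4⁻¹ * (hillWeight (gapSet G) * hillWeight (gapSet H)) := by
    rw [hillWeight_gapSet, hillWeight_gapSet,
      ← ENNReal.ofReal_toReal (a := 4⁻¹ * _) (by finiteness)]
    congr 1
    simp only [ENNReal.toReal_mul, ENNReal.toReal_inv, ENNReal.toReal_div, ENNReal.toReal_pow,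
      ENNReal.toReal_ofNat, ENNReal.toReal_natCast]
    rw [pow_add]
    ring
  rw [hvalue] at hlim
  refine hlim.congr fun m => ?_
  rw [show m + (gapSpan G + gapSpan H) = gapSpan G + (gapSpan H + m) by ring,
    fixCount_gapSet_union_revSet, add_assoc, ← mul_div_assoc,
    ENNReal.ofReal_div_of_pos (by exact_mod_cast catalan_pos _), ENNReal.ofReal_natCast,
    ← Nat.cast_mul, ← Nat.cast_mul, ENNReal.ofReal_natCast]

theorem tendsto_uniformOn_fixedPositions (p : PositionPair) :
    Tendsto (fun n => uniformOn (Av321 n) (fixedPositions ⁻¹' {p})) atTop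
      (nhds (4⁻¹ * (hillWeight p.left * hillWeight p.right))) := by
  obtain ⟨A, B⟩ := p
  obtain ⟨G, rfl⟩ := gapSet_surjective A
  obtain ⟨H, rfl⟩ := gapSet_surjective B
  refine (tendsto_fixCount_gapSet_div_catalan G H).congr' ?_
  filter_upwards [eventually_ge_atTop (2 * (gapSpan G + gapSpan H))] with n hn
  rw [← uniformOn_Av321_fixedSet]
  congr 1
  ext τ
  exact (fixedPositions_eq_iff τ ((gapSet_subset G).trans (Finset.range_mono (by omega)))
    ((gapSet_subset H).trans (Finset.range_mono (by omega)))).symm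

end FixedPositions

theorem tendstoInDistribution_of_tendsto_singleton {S : Type*} [TopologicalSpace S]
    [DiscreteTopology S] [MeasurableSpace S] [BorelSpace S] [Countable S]
    {Ω : Type*} [MeasurableSpace Ω] {μ : Measure Ω} [IsProbabilityMeasure μ]
    {Ω' : ℕ → Type*} [∀ n, MeasurableSpace (Ω' n)]
    {P : (n : ℕ) → Measure (Ω' n)} [∀ n, IsProbabilityMeasure (P n)]
    {Y : (n : ℕ) → Ω' n → S} {Z : Ω → S} (hY : ∀ n, AEMeasurable (Y n) (P n))
    (hZ : AEMeasurable Z μ)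
    (h : ∀ s, Tendsto (fun n => P n (Y n ⁻¹' {s})) atTop (nhds (μ (Z ⁻¹' {s})))) :
    TendstoInDistribution Y atTop Z P μ := by
  refine ⟨hY, hZ, tendsto_of_forall_isOpen_le_liminf' fun G _ => ?_⟩
  have hmeas (A : Set S) : MeasurableSet A := A.to_countable.measurableSet
  have hsum (ν : Measure S) : ν G = ∫⁻ s, G.indicator (fun x => ν {x}) s ∂Measure.count := by
    rw [lintegral_count, Measure.tsum_indicator_apply_singleton _ _ (hmeas G)]
  have hlim (s : S) : Tendsto (fun n => G.indicator (fun x => (P n).map (Y n) {x}) s) atTop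
      (nhds (G.indicator (fun x => μ.map Z {x}) s)) := by
    by_cases hs : s ∈ G
    · simp only [Set.indicator_of_mem hs, Measure.map_apply_of_aemeasurable (hY _) (hmeas _),
        Measure.map_apply_of_aemeasurable hZ (hmeas _)]
      exact h s
    · simp only [Set.indicator_of_notMem hs]
      exact tendsto_const_nhds
  -- Lower semicontinuity on open sets is Fatou's lemma for the counting measure.
  calc μ.map Z G = ∫⁻ s, liminf (fun n => G.indicator (fun x => (P n).map (Y n) {x}) s) atTop
        ∂Measure.count := by
        rw [hsum]
        exact lintegral_congr fun s => (hlim s).liminf_eq.symm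
    _ ≤ liminf (fun n => ∫⁻ s, G.indicator (fun x => (P n).map (Y n) {x}) s ∂Measure.count) atTop :=
        lintegral_liminf_le fun n => measurable_of_countable _
    _ = liminf (fun n => (P n).map (Y n) G) atTop := by simp only [← hsum]

theorem mainTheorem2
    {Ω : Type*} [MeasurableSpace Ω] (μ : Measure Ω) [IsProbabilityMeasure μ]
    (T : ℕ+ → Ω → OrderedTree) (X N : Ω → ℕ+)
    (hT : ∀ j, IsGaltonWatsonTree geomHalf (T j) μ)
    (hT_indep : iIndepFun T μ)
    (hX_meas : Measurable X) (hN_meas : Measurable N)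
    (hX : ∀ k : ℕ+, μ (X ⁻¹' {k}) = sizeBiased geomHalf k)
    (hN : ∀ k m : ℕ+, m ≤ k → (cond μ (X ⁻¹' {k})) (N ⁻¹' {m}) = (k : ℝ≥0∞)⁻¹)
    (hXN_indep : IndepFun (fun ω => (X ω, N ω)) (fun ω j => T j ω) μ)
    {Ω' : ℕ → Type*} [∀ n, MeasurableSpace (Ω' n)]
    (P : (n : ℕ) → Measure (Ω' n)) [∀ n, IsProbabilityMeasure (P n)]
    (τ : (n : ℕ) → Ω' n → Equiv.Perm (Fin n))
    (hτ : ∀ n, HasLaw (τ n) (uniformOn (Av321 n)) (P n)) :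
    TendstoInDistribution (fun n ω => fixedPointPair (τ n ω)) atTop
      (fun ω => spinePair (fun j => T j ω) (X ω) (N ω)) P μ := by
  have hpositions : TendstoInDistribution (fun n ω => fixedPositions (τ n ω)) atTop
      (fun ω => spinePositions (fun j => T j ω) (X ω) (N ω)) P μ := by
    refine tendstoInDistribution_of_tendsto_singleton
      (fun n => (Measurable.of_discrete (f := fixedPositions)).comp_aemeasurable
        (hτ n).aemeasurable)
      (measurable_spinePositions (fun j => (hT j).1) hX_meas hN_meas).aemeasurable fun p => ?_
    rw [measure_spinePositions hT hT_indep hX_meas hN_meas hX hN hXN_indep]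
    exact (tendsto_uniformOn_fixedPositions p).congr fun n =>
      ((hτ n).measure_eq MeasurableSet.of_discrete).symm
  refine (hpositions.continuous_comp (g := pointMeasurePair) continuous_of_discreteTopology).congr
    (fun n => ae_of_all _ fun ω => pointMeasurePair_fixedPositions (τ n ω)) ?_
  filter_upwards [ae_all_iff.2 fun j => (hT j).ae_natSize_ne_zero] with ω hω
  exact pointMeasurePair_spinePositions hω (X ω) (N ω)
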